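/- Let $m,n_1,n_2,n_3$ be positive integers with $m\ge n_1+n_2+n_3$. A transmitter with $m$ antennas communicates with receivers $\mathrm{Rx}_1,\mathrm{Rx}_2,\mathrm{Rx}_3$, where $\mathrm{Rx}_j$ has $n_j$ antennas. At time $t=1,\dots,n$ receiver $\mathrm{Rx}_j$ observes $$\vec y_j(t)=g_j(t)\,\vec x(t)+\vec z_j(t)\in\mathbb C^{n_j},$$ where $\vec x(t)\in\mathbb C^m$ is the transmitted vector, $g_j(t)\in\mathbb C^{n_j\times m}$ is the channel matrix and $\vec z_j(t)\sim\mathcal{CN}(0,I_{n_j})$ is noise, independent over $t$ and $j$. All entries of all matrices $g_j(t)$ are i.i.d.; their common law may depend on the power $p$, is supported in $\{|g|\le d_{\max}\}$ with $d_{\max}$ independent of $p$, and has a density with respect to Lebesgue measure on $\mathbb C$ that is at most $f_{\max}(p)$, where $f_{\max}(p)=o(\log p)$ as $p\to\infty$. The message $W$ is uniformly distributed on $\{1,\dots,M\}$, and $W$, the channel matrices and the noise are independent. $\mathrm{Rx}_2$ and $\mathrm{Rx}_3$ supply no channel state information to the transmitter and $\mathrm{Rx}_1$ supplies delayed channel state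 information: an encoding strategy of block length $n$ and power $p>0$ consists of $M\ge 1$ and measurable functions $f_t$, $1\le t\le n$, with $\vec x(t)=f_t\big(W,g_1(1),\dots,g_1(t-1)\big)$ and $\frac1n\mathbb E\sum_{t=1}^n\|\vec x(t)\|^2\le p$. Write $\vec y_j^n=(\vec y_j(1),\dots,\vec y_j(n))$ and let $\mathcal G^n$ be the collection of all channel matrices $g_j(t)$, $1\le j\le 3$, $1\le t\le n$. For random vectors let $h(Y\mid X)=-\mathbb E[\log f_{Y|X}(Y|X)]$ denote conditional differential entropy, where $f_{Y|X}$ is the conditional density with respect to Lebesgue measure. Then there is a function $\varepsilon$ with $\varepsilon(p)=o(\log p)$ as $p\to\infty$, depending only on $m,n_1,n_2,n_3,d_{\max}$ and the function $f_{\max}$, such that for every $p>0$, every admissible channel law at power $p$, every block length $n$ and every encoding strategy of block length $n$ and power $p$, both conditional differential entropies below are well defined and finite and $$\frac{h(\vec y_1^n\mid \vec y_2^n,\vec y_3^n,\mathcal G^n)}{n_1}\;\le\;\frac{h(\vec y_2^n\mid \vec y_3^n,\mathcal G^n)}{n_2}+n\,\varepsilon(p).$$ -/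

import Mathlib

open MeasureTheory Asymptotics Filter
open scoped ENNReal

noncomputable section

namespace MIMOME

/-! ### Conditional differential entropy -/

section Entropy

variable {Ω α E : Type*} [MeasurableSpace Ω] [MeasurableSpace α] [MeasureSpace E]

/-- The conditional density `f_{Y|X}(y|x)` of `Y` given `X` with respect to Lebesgue measure, at
`q = (x, y)`: the density of the law of `(X, Y)` relative to (law of `X`) `×` (volume). -/
def condDensity (P : Measure Ω) (Y : Ω → E) (X : Ω → α) (q : α × E) : ℝ :=
  ((P.map fun ω => (X ω, Y ω)).rnDeriv ((P.map X).prod volume) q).toReal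

/-- The conditional differential entropy `h(Y | X) = -𝔼[log f_{Y|X}(Y|X)]`, in nats. -/
def condDiffEntropy (P : Measure Ω) (Y : Ω → E) (X : Ω → α) : ℝ :=
  -∫ q, Real.log (condDensity P Y X q) ∂(P.map fun ω => (X ω, Y ω))

/-- `h(Y | X)` is well defined and finite: the conditional density exists and its logarithm is
integrable. -/
def HasCondDiffEntropy (P : Measure Ω) (Y : Ω → E) (X : Ω → α) : Prop :=
  (P.map fun ω => (X ω, Y ω)) ≪ (P.map X).prod volume ∧
    Integrable (fun q => Real.log (condDensity P Y X q)) (P.map fun ω => (X ω, Y ω))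

end Entropy

/-! ### The channel -/

/-- The circularly symmetric complex Gaussian law `𝒞𝒩(0, 1)`. -/
def complexGaussian : Measure ℂ :=
  volume.withDensity fun z => ENNReal.ofReal (Real.exp (-‖z‖ ^ 2) / Real.pi)

/-- `ν` is an admissible law of a single channel coefficient: a probability law on `ℂ`, carried by
the disc of radius `dmax`, with a density with respect to Lebesgue measure bounded by `fmax`. -/
structure IsChannelLaw (dmax fmax : ℝ) (ν : Measure ℂ) : Prop where
  isProbabilityMeasure : IsProbabilityMeasure ν
  norm_le : ∀ᵐ g ∂ν, ‖g‖ ≤ dmax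
  density : ∃ φ : ℂ → ℝ, Measurable φ ∧ (∀ g, 0 ≤ φ g ∧ φ g ≤ fmax) ∧
    ν = volume.withDensity fun g => ENNReal.ofReal (φ g)

/-- All channel coefficients over `n` time slots: `G t j r i` is the coefficient at time `t` from
transmit antenna `i` to antenna `r` of receiver `j`. There are three receivers `0, 1, 2`, and
receiver `j` has `N j` antennas. -/
abbrev Channels (n m : ℕ) (N : Fin 3 → ℕ) : Type :=
  Fin n → (j : Fin 3) → Fin (N j) → Fin m → ℂ

/-- All additive noise variables: `z t j r` is the noise at antenna `r` of receiver `j`. -/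
abbrev Noise (n : ℕ) (N : Fin 3 → ℕ) : Type :=
  Fin n → (j : Fin 3) → Fin (N j) → ℂ

/-- An outcome: the message, the channel coefficients and the noise. -/
abbrev Outcome (M n m : ℕ) (N : Fin 3 → ℕ) : Type :=
  Fin M × Channels n m N × Noise n N

/-- The joint law: the message is uniform, the channel coefficients are i.i.d. with law `ν`, the
noise variables are i.i.d. `𝒞𝒩(0, 1)`, and the three families are independent. -/
def law (M n m : ℕ) [NeZero M] (N : Fin 3 → ℕ) (ν : Measure ℂ) : Measure (Outcome M n m N) :=
  (PMF.uniformOfFintype (Fin M)).toMeasure.prod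
    ((Measure.pi fun _ => Measure.pi fun _ => Measure.pi fun _ => Measure.pi fun _ => ν).prod
      (Measure.pi fun _ => Measure.pi fun _ => Measure.pi fun _ => complexGaussian))

/-- An encoding strategy of block length `n` for `M` messages and `m` transmit antennas with
delayed channel knowledge of one receiver with `k` antennas and none of the other receivers: the
vector sent at time `t` is a function of the message and of the channel matrices of that receiver
at the times `s < t`. -/
structure Encoder (M n m k : ℕ) where
  toFun : (t : Fin n) → Fin M → (Fin t → Fin k → Fin m → ℂ) → Fin m → ℂ
  measurable_toFun : ∀ t w, Measurable (toFun t w)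

variable {M n m : ℕ} {N : Fin 3 → ℕ}

/-- The transmitted vector `x(t)`; receiver `0` supplies delayed channel knowledge. -/
def Encoder.input (f : Encoder M n m (N 0)) (t : Fin n) (ω : Outcome M n m N) : Fin m → ℂ :=
  f.toFun t ω.1 fun s => ω.2.1 (Fin.castLE t.isLt.le s) 0

/-- The signal `y_jⁿ` received by receiver `j`: `y_j(t) = g_j(t) x(t) + z_j(t)`. -/
def Encoder.output (f : Encoder M n m (N 0)) (j : Fin 3) (ω : Outcome M n m N) :
    Fin n → Fin (N j) → ℂ :=
  fun t r => ∑ i, ω.2.1 t j r i * f.input t ω i + ω.2.2 t j r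

/-- The average power constraint `(1/n) 𝔼‖xⁿ‖² ≤ p`. -/
def Encoder.PowerConstraint [NeZero M] (f : Encoder M n m (N 0)) (ν : Measure ℂ) (p : ℝ) : Prop :=
  ∫⁻ ω, ∑ t, ∑ i, ENNReal.ofReal (‖f.input t ω i‖ ^ 2) ∂(law M n m N ν) ≤ ENNReal.ofReal (n * p)

end MIMOME

end

namespace MIMOME

/-! ### The Gaussian noise -/

/-! Once the channel is fixed, the outputs form a finite Gaussian mixture: one mean vector per
message, plus white noise. For a set `S` of space-time antennas, `mixEntropy` is the entropy of the
outputs in `S`, and `avgEntropy` its mean over the channel, both up to a summand `log M`. The two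
conditional entropies of the theorem are differences of values of `avgEntropy`
(`condDiffEntropy_first`, `condDiffEntropy_second`), so this summand cancels. What remains is a
statement about one set function, resting on two facts.

The first is submodularity (`diminishingIncrements_avgEntropy`): conditioning does not increase
entropy.

The second is an exchange inequality (`avgEntropy_exchange_le`): for any set `D` of other outputs,
replacing an antenna `a` of receiver `1` by an antenna `b` of receiver `0` at the same time raises
the entropy by at most an explicit constant, apart from a term in the power. Receiver `1` feeds
nothing back, so the channel row of `a` is independent of all inputs, even of those sent later
(`Encoder.mean_update`). Thus `a` observes a generic linear form of the input, while `b` observes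
one with bounded coefficients. Averaging the Gaussian density over the generic row yields at most `C
/ (1 + K‖v‖²)`, where `v` is the difference of two candidate inputs. By Jensen, this bounds the
entropy at `a` from below (`IsChannelLaw.neg_log_le`). At `b`, Gibbs' inequality bounds the entropy
from above by the cost of any test density. The test density used is the posterior mean of the
kernel `1 / (1 + |u|²)`, which decays at the same rate, so the two bounds match term by term. This
kernel just fails to be integrable on the plane; the weight `(1 + |u|²)^(-δ)` restores integrability
at the cost of `log (1/δ)` plus `δ` times the mean of `log (1 + |y|²)`. For `δ = 1 / (1 + log (1 +
p))` this is of order `log log p`.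

The combinatorial conclusion is `DiminishingIncrements.blocks_le`. Let `B r` and `C k` be the rows
over all times of antennas of receivers `0` and `1`. Given all outputs of receivers `1` and `2`, the
entropy of `B r` is at most that of `C k` given the remaining rows, plus the exchange cost. Summing
over `k` by a Han type inequality and over `r` by subadditivity yields the normalised comparison. -/

/-- The density of `𝒞𝒩(0, 1)`. -/
noncomputable def gaussDensity (z : ℂ) : ℝ := Real.exp (-‖z‖ ^ 2) / Real.pi

lemma gaussDensity_pos (z : ℂ) : 0 < gaussDensity z := by
  unfold gaussDensity; positivity

lemma gaussDensity_le (z : ℂ) : gaussDensity z ≤ 1 / Real.pi := by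
  unfold gaussDensity
  gcongr
  exact Real.exp_le_one_iff.2 (by simp)

lemma log_gaussDensity (z : ℂ) : Real.log (gaussDensity z) = -‖z‖ ^ 2 - Real.log Real.pi := by
  rw [gaussDensity, Real.log_div (Real.exp_pos _).ne' Real.pi_ne_zero, Real.log_exp]

@[fun_prop]
lemma continuous_gaussDensity : Continuous gaussDensity := by
  unfold gaussDensity; fun_prop

@[fun_prop]
lemma measurable_gaussDensity : Measurable gaussDensity := continuous_gaussDensity.measurable

lemma complexGaussian_eq :
    complexGaussian = volume.withDensity fun z => ENNReal.ofReal (gaussDensity z) := rfl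

lemma integral_gaussDensity : ∫ z, gaussDensity z = 1 := by
  have h := Complex.integral_exp_neg_rpow (p := 2) (by norm_num)
  norm_num [Real.Gamma_two] at h
  simp only [gaussDensity, integral_div, h]
  exact div_self Real.pi_ne_zero

/-- A non-integrable function has Bochner integral `0`, whereas this integral is `1`. -/
lemma integrable_gaussDensity : Integrable gaussDensity := by
  by_contra h
  simpa [integral_undef h] using integral_gaussDensity

lemma lintegral_gaussDensity : ∫⁻ z, ENNReal.ofReal (gaussDensity z) = 1 := by
  rw [← ofReal_integral_eq_lintegral_ofReal integrable_gaussDensity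
    (ae_of_all _ fun z => (gaussDensity_pos z).le), integral_gaussDensity, ENNReal.ofReal_one]

instance : IsProbabilityMeasure complexGaussian :=
  ⟨by rw [complexGaussian_eq, withDensity_apply _ MeasurableSet.univ]; simpa using lintegral_gaussDensity⟩

lemma integrable_norm_sq_complexGaussian : Integrable (fun z => ‖z‖ ^ 2) complexGaussian := by
  have h := Complex.integral_rpow_mul_exp_neg_rpow (p := 2) (q := 2) (by norm_num) (by norm_num)
  norm_num [Real.Gamma_two] at h
  have h2 : Integrable fun z : ℂ => ‖z‖ ^ 2 * Real.exp (-‖z‖ ^ 2) := by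
    by_contra h'
    rw [integral_undef h'] at h
    exact Real.pi_ne_zero h.symm
  rw [complexGaussian_eq, integrable_withDensity_iff (by fun_prop) (by simp)]
  refine (h2.div_const Real.pi).congr (ae_of_all _ fun z => ?_)
  simp only
  rw [ENNReal.toReal_ofReal (gaussDensity_pos z).le, gaussDensity]
  ring

/-! ### Products of measures with densities -/

lemma lintegral_pi_fin_prod {E : Type*} [MeasurableSpace E] {n : ℕ} (ρ : Fin n → Measure E)
    [∀ i, SigmaFinite (ρ i)] (f : Fin n → E → ℝ≥0∞) (hf : ∀ i, Measurable (f i)) :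
    ∫⁻ y, ∏ i, f i (y i) ∂(Measure.pi ρ) = ∏ i, ∫⁻ u, f i u ∂(ρ i) := by
  induction n with
  | zero => simp
  | succ n ih =>
    have hm : ∀ i : Fin (n + 1), Measurable fun y : Fin (n + 1) → E => f i (y i) :=
      fun i => (hf i).comp (measurable_pi_apply i)
    rw [← ((measurePreserving_piFinSuccAbove ρ 0).symm).lintegral_comp
      (Finset.measurable_prod _ fun i _ => hm i)]
    simp only [Fin.prod_univ_succ, MeasurableEquiv.piFinSuccAbove_symm_apply,
      Fin.insertNthEquiv_apply, Fin.insertNth_zero', Fin.cons_zero, Fin.cons_succ]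
    rw [lintegral_prod_mul (f := f 0) (g := fun y : Fin n → E => ∏ i, f i.succ (y i))
      (hf 0).aemeasurable (Finset.measurable_prod _ fun i _ =>
        (hf i.succ).comp (measurable_pi_apply i)).aemeasurable]
    congr 1
    exact ih (fun i => ρ i.succ) (fun i => f i.succ) fun i => hf i.succ

lemma lintegral_pi_prod {ι E : Type*} [Fintype ι] [MeasurableSpace E] (ρ : ι → Measure E)
    [∀ i, SigmaFinite (ρ i)] (f : ι → E → ℝ≥0∞) (hf : ∀ i, Measurable (f i)) :
    ∫⁻ y, ∏ i, f i (y i) ∂(Measure.pi ρ) = ∏ i, ∫⁻ u, f i u ∂(ρ i) := by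
  let e := (Fintype.equivFin ι).symm
  have hm : ∀ i : ι, Measurable fun y : ι → E => f i (y i) :=
    fun i => (hf i).comp (measurable_pi_apply i)
  rw [← (measurePreserving_piCongrLeft ρ e).lintegral_comp
    (Finset.measurable_prod _ fun i _ => hm i)]
  simp only [← e.prod_comp, MeasurableEquiv.piCongrLeft_apply_apply]
  exact lintegral_pi_fin_prod (fun i => ρ (e i)) (fun i => f (e i)) fun i => hf (e i)

lemma pi_withDensity {ι E : Type*} [Fintype ι] [MeasurableSpace E] (ρ : Measure E)
    [SigmaFinite ρ] (f : E → ℝ≥0∞) (hf : Measurable f) [SigmaFinite (ρ.withDensity f)] :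
    Measure.pi (fun _ : ι => ρ.withDensity f) =
      (Measure.pi fun _ : ι => ρ).withDensity fun y => ∏ i, f (y i) := by
  refine Measure.pi_eq fun s hs => ?_
  rw [withDensity_apply _ (MeasurableSet.univ_pi hs), Measure.restrict_pi_pi,
    lintegral_pi_prod _ _ fun _ => hf]
  exact Finset.prod_congr rfl fun i _ => (withDensity_apply _ (hs i)).symm

lemma map_restrict_eval_pi {ι E : Type*} [Fintype ι] [MeasurableSpace E] (ρ : Measure E)
    [IsProbabilityMeasure ρ] (T : Finset ι) (a : ι) (ha : a ∉ T) :
    (Measure.pi fun _ : ι => ρ).map (fun z => (T.restrict z, z a)) =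
      (Measure.pi fun _ : T => ρ).prod ρ := by
  classical
  have hi : ProbabilityTheory.iIndepFun (fun (i : ι) (z : ι → E) => z i)
      (Measure.pi fun _ : ι => ρ) :=
    ProbabilityTheory.iIndepFun_pi (X := fun _ => id) fun _ => aemeasurable_id
  have h2 := hi.indepFun_finset T {a} (by simpa using ha) fun i => measurable_pi_apply i
  have h3 : ProbabilityTheory.IndepFun (fun z : ι → E => T.restrict z) (fun z : ι → E => z a)
      (Measure.pi fun _ : ι => ρ) :=
    h2.comp (φ := id) (ψ := fun y : ({a} : Finset ι) → E => y ⟨a, by simp⟩) measurable_id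
      (measurable_pi_apply _)
  rw [(ProbabilityTheory.indepFun_iff_map_prod_eq_prod_map_map
    (by fun_prop) (measurable_pi_apply a).aemeasurable).1 h3, (measurePreserving_eval (fun _ : ι => ρ) a).map_eq]
  congr 1
  rw [← Measure.infinitePi_eq_pi, Measure.infinitePi_map_restrict]

lemma measurePreserving_flatten {n : ℕ} {N : Fin 3 → ℕ} {E : Type*} [MeasurableSpace E]
    (ρ : Measure E) [SigmaFinite ρ] :
    MeasurePreserving (fun (z : Fin n → (j : Fin 3) → Fin (N j) → E)
        (i : Σ _ : Fin n, Σ j : Fin 3, Fin (N j)) => z i.1 i.2.1 i.2.2)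
      (Measure.pi fun _ => Measure.pi fun _ => Measure.pi fun _ => ρ) (Measure.pi fun _ => ρ) := by
  refine ⟨by fun_prop, (Measure.pi_eq fun s hs => ?_).symm⟩
  rw [Measure.map_apply (by fun_prop) (MeasurableSet.univ_pi hs)]
  have : (fun (z : Fin n → (j : Fin 3) → Fin (N j) → E)
        (i : Σ _ : Fin n, Σ j : Fin 3, Fin (N j)) => z i.1 i.2.1 i.2.2) ⁻¹' (Set.univ.pi s) =
      Set.univ.pi fun t => Set.univ.pi fun j => Set.univ.pi fun r => s ⟨t, j, r⟩ := by
    ext z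
    simp only [Set.mem_preimage, Set.mem_univ_pi, Sigma.forall]
  rw [this]
  simp only [Measure.pi_pi, ← Finset.univ_sigma_univ, Finset.prod_sigma]

/-- Splitting the noise of three receivers into the blocks of the receivers. -/
lemma map_blocks {n : ℕ} {N : Fin 3 → ℕ} {E : Type*} [MeasurableSpace E]
    (ρ : Measure E) [IsProbabilityMeasure ρ] :
    (Measure.pi fun _ : Fin n => Measure.pi fun j : Fin 3 => Measure.pi fun _ : Fin (N j) => ρ).map
      (fun z => (((fun t => z t 1), (fun t => z t 2)), fun t => z t 0)) =
      ((Measure.pi fun _ : Fin n => Measure.pi fun _ : Fin (N 1) => ρ).prod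
        (Measure.pi fun _ : Fin n => Measure.pi fun _ : Fin (N 2) => ρ)).prod
        (Measure.pi fun _ : Fin n => Measure.pi fun _ : Fin (N 0) => ρ) := by
  have hs : MeasurePreserving (fun z : (j : Fin 3) → Fin (N j) → E => ((z 1, z 2), z 0))
      (Measure.pi fun j : Fin 3 => Measure.pi fun _ : Fin (N j) => ρ)
      (((Measure.pi fun _ : Fin (N 1) => ρ).prod (Measure.pi fun _ : Fin (N 2) => ρ)).prod
        (Measure.pi fun _ : Fin (N 0) => ρ)) := by
    refine ⟨by fun_prop, ?_⟩
    let d : ((Fin (N 1) → E) × (Fin (N 2) → E)) × (Fin (N 0) → E) →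
        (j : Fin 3) → Fin (N j) → E :=
      fun q j => match j with | 0 => q.2 | 1 => q.1.1 | 2 => q.1.2
    have hd : Measurable d := by
      refine measurable_pi_iff.2 fun j => ?_
      fin_cases j
      · exact measurable_snd
      · exact measurable_fst.comp measurable_fst
      · exact measurable_snd.comp measurable_fst
    have : (Measure.pi fun j : Fin 3 => Measure.pi fun _ : Fin (N j) => ρ) =
        (((Measure.pi fun _ : Fin (N 1) => ρ).prod (Measure.pi fun _ : Fin (N 2) => ρ)).prod
        (Measure.pi fun _ : Fin (N 0) => ρ)).map d := by
      refine Measure.pi_eq fun s hs => ?_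
      rw [Measure.map_apply hd (MeasurableSet.univ_pi hs)]
      have : d ⁻¹' Set.univ.pi s = (s 1 ×ˢ s 2) ×ˢ s 0 := by
        ext q
        simp only [Set.mem_preimage, Set.mem_univ_pi, Fin.forall_fin_succ, Set.mem_prod]
        simp [d]
        tauto
      rw [this, Measure.prod_prod, Measure.prod_prod, Fin.prod_univ_three]
      ring
    rw [this, Measure.map_map (by fun_prop) hd]
    exact Measure.map_id
  have h1 := measurePreserving_pi (ι := Fin n) _ _ fun _ => hs
  have h2 := measurePreserving_arrowProdEquivProdArrow ((Fin (N 1) → E) × (Fin (N 2) → E))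
    (Fin (N 0) → E) (Fin n)
    (fun _ => (Measure.pi fun _ : Fin (N 1) => ρ).prod (Measure.pi fun _ : Fin (N 2) => ρ))
    (fun _ => Measure.pi fun _ : Fin (N 0) => ρ)
  have h3 := measurePreserving_arrowProdEquivProdArrow (Fin (N 1) → E) (Fin (N 2) → E) (Fin n)
    (fun _ => Measure.pi fun _ : Fin (N 1) => ρ) (fun _ => Measure.pi fun _ : Fin (N 2) => ρ)
  exact (((h3.prod (MeasurePreserving.id _)).comp h2).comp h1).map_eq

/-! ### Mixtures of translates -/

/-- The uniform law of the message. -/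
noncomputable abbrev messageLaw (M : ℕ) [NeZero M] : Measure (Fin M) :=
  (PMF.uniformOfFintype (Fin M)).toMeasure

lemma lintegral_messageLaw (M : ℕ) [NeZero M] (f : Fin M → ℝ≥0∞) :
    ∫⁻ w, f w ∂(messageLaw M) = (M : ℝ≥0∞)⁻¹ * ∑ w, f w := by
  rw [lintegral_fintype, Finset.mul_sum]
  refine Finset.sum_congr rfl fun w _ => ?_
  rw [PMF.toMeasure_apply_singleton _ _ (MeasurableSet.singleton w), PMF.uniformOfFintype_apply,
    Fintype.card_fin, mul_comm]

/-- The conditional differential entropy computed from an explicit conditional density. -/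
lemma condDiffEntropy_of_withDensity {Ω α γ : Type*} [MeasurableSpace Ω] [MeasureSpace α]
    [SigmaFinite (volume : Measure α)] [MeasurableSpace γ] {P : Measure Ω} [IsProbabilityMeasure P]
    {X : Ω → γ} {Y : Ω → α} (hX : Measurable X) (hY : Measurable Y) {r : γ × α → ℝ≥0∞}
    (hr : Measurable r)
    (h : P.map (fun ω => (X ω, Y ω)) = ((P.map X).prod volume).withDensity r) {ℓ : Ω → ℝ}
    (hℓ : ∀ ω, Real.log (r (X ω, Y ω)).toReal = ℓ ω) (hi : Integrable ℓ P) :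
    HasCondDiffEntropy P Y X ∧ condDiffEntropy P Y X = -∫ ω, ℓ ω ∂P := by
  have : IsProbabilityMeasure (P.map X) := Measure.isProbabilityMeasure_map hX.aemeasurable
  have hac : (P.map fun ω => (X ω, Y ω)) ≪ (P.map X).prod volume := by
    rw [h]; exact withDensity_absolutelyContinuous _ _
  have hd : (fun q => Real.log (condDensity P Y X q)) =ᵐ[P.map fun ω => (X ω, Y ω)]
      fun q => Real.log (r q).toReal := by
    refine hac.ae_le ?_
    have := Measure.rnDeriv_withDensity ((P.map X).prod volume) hr
    filter_upwards [this] with q hq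
    rw [condDensity, h, hq]
  have hXY : Measurable fun ω => (X ω, Y ω) := hX.prodMk hY
  have hlog : Measurable fun q => Real.log (r q).toReal := by fun_prop
  have hcomp : (fun q => Real.log (r q).toReal) ∘ (fun ω => (X ω, Y ω)) = ℓ := funext hℓ
  refine ⟨⟨hac, ?_⟩, ?_⟩
  · rw [integrable_congr hd, integrable_map_measure hlog.aestronglyMeasurable hXY.aemeasurable,
      hcomp]
    exact hi
  · rw [condDiffEntropy, integral_congr_ae hd,
      integral_map hXY.aemeasurable hlog.aestronglyMeasurable]
    exact congrArg _ (integral_congr_ae (ae_of_all _ hℓ))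

section Mixture

variable {Z α β : Type*} [MeasurableSpace Z]
  [MeasureSpace α] [AddCommGroup α] [MeasurableAdd₂ α] [MeasurableSub₂ α]
  [SigmaFinite (volume : Measure α)] [(volume : Measure α).IsAddLeftInvariant]
  [MeasureSpace β] [AddCommGroup β] [MeasurableAdd₂ β] [MeasurableSub₂ β]
  [SigmaFinite (volume : Measure β)] [(volume : Measure β).IsAddLeftInvariant]
  {M : ℕ} [NeZero M] {ζ : Measure Z} {eB : Z → β} {eA : Z → α} {ψB : β → ℝ≥0∞} {ψA : α → ℝ≥0∞}

/-- The sum of the translates of a density. -/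
noncomputable def shiftSum (ψ : β → ℝ≥0∞) (μ : Fin M → β) (y : β) : ℝ≥0∞ := ∑ w, ψ (y - μ w)

/-- The sum of the translates of a product density. -/
noncomputable def shiftSum₂ (ψB : β → ℝ≥0∞) (ψA : α → ℝ≥0∞) (μB : Fin M → β) (μA : Fin M → α)
    (q : β × α) : ℝ≥0∞ := ∑ w, ψB (q.1 - μB w) * ψA (q.2 - μA w)

lemma lintegral_mixture (heB : Measurable eB) (heA : Measurable eA) (hψB : Measurable ψB)
    (hψA : Measurable ψA) [SFinite (volume.withDensity ψA)]
    (h : ζ.map (fun z => (eB z, eA z)) = (volume.withDensity ψB).prod (volume.withDensity ψA))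
    (μB : Fin M → β) (μA : Fin M → α) (F : β × α → ℝ≥0∞) (hF : Measurable F) :
    ∫⁻ w, ∫⁻ z, F (μB w + eB z, μA w + eA z) ∂ζ ∂(messageLaw M) =
      (M : ℝ≥0∞)⁻¹ * ∫⁻ q, F q * shiftSum₂ ψB ψA μB μA q := by
  rw [lintegral_messageLaw]
  congr 1
  simp only [shiftSum₂, Finset.mul_sum]
  rw [lintegral_finsetSum _ fun w _ => by fun_prop]
  refine Finset.sum_congr rfl fun w _ => ?_
  have hs : MeasurePreserving (Prod.map (μB w + ·) (μA w + ·)) (volume : Measure (β × α)) volume :=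
    (measurePreserving_add_left volume (μB w)).prod (measurePreserving_add_left volume (μA w))
  have hFs : Measurable fun q : β × α => F (Prod.map (μB w + ·) (μA w + ·) q) :=
    hF.comp hs.measurable
  have h1 : ∫⁻ z, F (μB w + eB z, μA w + eA z) ∂ζ =
      ∫⁻ q, F (Prod.map (μB w + ·) (μA w + ·) q) ∂(ζ.map fun z => (eB z, eA z)) := by
    rw [lintegral_map hFs (by fun_prop)]; rfl
  rw [h1, h, prod_withDensity hψB hψA,
    lintegral_withDensity_eq_lintegral_mul _ (by fun_prop) hFs,
    ← hs.lintegral_comp (f := fun q => F q * (ψB (q.1 - μB w) * ψA (q.2 - μA w))) (by fun_prop)]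
  refine lintegral_congr fun q => ?_
  simp [mul_comm]

omit [MeasurableAdd₂ β] [SigmaFinite (volume : Measure β)]
  [(volume : Measure β).IsAddLeftInvariant] [NeZero M] in
lemma lintegral_shiftSum₂_fst (hψB : Measurable ψB) (hψA : Measurable ψA) (hA : ∫⁻ u, ψA u = 1)
    (μB : Fin M → β) (μA : Fin M → α) (F : β → ℝ≥0∞) (hF : Measurable F) :
    ∫⁻ q : β × α, F q.1 * shiftSum₂ ψB ψA μB μA q = ∫⁻ y, F y * shiftSum ψB μB y := by
  have hm : Measurable (shiftSum₂ ψB ψA μB μA) := by unfold shiftSum₂; fun_prop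
  rw [Measure.volume_eq_prod, lintegral_prod _ (by fun_prop)]
  refine lintegral_congr fun y => ?_
  simp only
  rw [lintegral_const_mul _ (by fun_prop)]
  congr 1
  simp only [shiftSum₂, shiftSum]
  rw [lintegral_finsetSum _ fun w _ => by fun_prop]
  refine Finset.sum_congr rfl fun w _ => ?_
  rw [lintegral_const_mul _ (by fun_prop)]
  have := lintegral_add_right_eq_self (μ := (volume : Measure α)) ψA (-μA w)
  simp only [← sub_eq_add_neg] at this
  rw [this, hA, mul_one]

/-- Under a mixture law, the mean of the ratio of a conditional subprobability density to the true
conditional density is at most one. -/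
lemma lintegral_ratio_le_one (heB : Measurable eB) (heA : Measurable eA) (hψB : Measurable ψB)
    (hψA : Measurable ψA) [SFinite (volume.withDensity ψA)]
    (h : ζ.map (fun z => (eB z, eA z)) = (volume.withDensity ψB).prod (volume.withDensity ψA))
    (hB : ∫⁻ y, ψB y = 1) (hB0 : ∀ y, ψB y ≠ 0) (hA0 : ∀ y, ψA y ≠ 0)
    (hBt : ∀ y, ψB y ≠ ∞) (hAt : ∀ y, ψA y ≠ ∞)
    (μB : Fin M → β) (μA : Fin M → α) (r : β × α → ℝ≥0∞) (hr : Measurable r)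
    (hr1 : ∀ y, ∫⁻ u, r (y, u) ≤ 1) :
    ∫⁻ w, ∫⁻ z, (fun q : β × α => r q * shiftSum ψB μB q.1 / shiftSum₂ ψB ψA μB μA q)
      (μB w + eB z, μA w + eA z) ∂ζ ∂(messageLaw M) ≤ 1 := by
  have hm : Measurable (shiftSum₂ ψB ψA μB μA) := by unfold shiftSum₂; fun_prop
  have hm1 : Measurable (shiftSum ψB μB) := by unfold shiftSum; fun_prop
  rw [lintegral_mixture heB heA hψB hψA h μB μA
    (fun q : β × α => r q * shiftSum ψB μB q.1 / shiftSum₂ ψB ψA μB μA q) (by fun_prop)]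
  have hM : (M : ℝ≥0∞) ≠ 0 := by exact_mod_cast NeZero.ne M
  have hne : ∀ q, shiftSum₂ ψB ψA μB μA q ≠ 0 := fun q hq => by
    have := (Finset.sum_eq_zero_iff.1 hq) 0 (Finset.mem_univ _)
    simp [hB0, hA0] at this
  have hnt : ∀ q, shiftSum₂ ψB ψA μB μA q ≠ ∞ := fun q =>
    (ENNReal.sum_lt_top.2 fun w _ => ENNReal.mul_lt_top (hBt _).lt_top (hAt _).lt_top).ne
  -- The mixture density cancels the denominator; what is left is `r` against the unnormalised
  -- marginal, of total mass `M`.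
  simp only [ENNReal.div_mul_cancel (hne _) (hnt _)]
  rw [Measure.volume_eq_prod, lintegral_prod _ (by fun_prop)]
  have h2 : ∫⁻ y, ∫⁻ u : α, r (y, u) * shiftSum ψB μB y ≤ ∫⁻ y, shiftSum ψB μB y := by
    refine lintegral_mono fun y => ?_
    simp only
    rw [lintegral_mul_const _ (by fun_prop)]
    exact mul_le_of_le_one_left' (hr1 y)
  have h3 : ∫⁻ y, shiftSum ψB μB y = M := by
    simp only [shiftSum]
    rw [lintegral_finsetSum _ fun w _ => by fun_prop]
    have : ∀ w, ∫⁻ y, ψB (y - μB w) = 1 := fun w => by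
      have := lintegral_add_right_eq_self (μ := (volume : Measure β)) ψB (-μB w)
      simp only [← sub_eq_add_neg] at this
      rw [this, hB]
    simp [this]
  calc _ ≤ (M : ℝ≥0∞)⁻¹ * M := by gcongr; exact h2.trans h3.le
    _ = 1 := ENNReal.inv_mul_cancel hM (by simp)

/-- The conditional entropy of `Y` given `X`, where `X` is equivalent to an observation and a
parameter on which the mixture depends. -/
lemma condDiffEntropy_mixture {𝒢 γ : Type*} [MeasurableSpace 𝒢] [MeasurableSpace γ]
    {Γ : Measure 𝒢} [IsProbabilityMeasure Γ] [IsProbabilityMeasure ζ]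
    (heB : Measurable eB) (heA : Measurable eA) (hψB : Measurable ψB)
    (hψA : Measurable ψA) [SFinite (volume.withDensity ψA)]
    (h : ζ.map (fun z => (eB z, eA z)) = (volume.withDensity ψB).prod (volume.withDensity ψA))
    (hA : ∫⁻ u, ψA u = 1) (hB0 : ∀ y, ψB y ≠ 0) (hBt : ∀ y, ψB y ≠ ∞)
    (μB : 𝒢 → Fin M → β) (μA : 𝒢 → Fin M → α) (hμB : ∀ w, Measurable fun g => μB g w)
    (hμA : ∀ w, Measurable fun g => μA g w) (e : β × 𝒢 ≃ᵐ γ)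
    (X : Fin M × 𝒢 × Z → γ) (Y : Fin M × 𝒢 × Z → α)
    (hX : ∀ ω, X ω = e (μB ω.2.1 ω.1 + eB ω.2.2, ω.2.1))
    (hY : ∀ ω, Y ω = μA ω.2.1 ω.1 + eA ω.2.2) {ℓ : Fin M × 𝒢 × Z → ℝ}
    (hi : Integrable ℓ ((messageLaw M).prod (Γ.prod ζ)))
    (hℓ : ∀ w g z, Real.log (shiftSum₂ ψB ψA (μB g) (μA g) (μB g w + eB z, μA g w + eA z) /
      shiftSum ψB (μB g) (μB g w + eB z)).toReal = ℓ (w, g, z)) :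
    HasCondDiffEntropy ((messageLaw M).prod (Γ.prod ζ)) Y X ∧
      condDiffEntropy ((messageLaw M).prod (Γ.prod ζ)) Y X =
        -∫ ω, ℓ ω ∂((messageLaw M).prod (Γ.prod ζ)) := by
  have hB' : Measurable fun p : Fin M × 𝒢 => μB p.2 p.1 := measurable_from_prod_countable_right hμB
  have hA' : Measurable fun p : Fin M × 𝒢 => μA p.2 p.1 := measurable_from_prod_countable_right hμA
  have hXm : Measurable X := by
    rw [funext hX]
    exact e.measurable.comp ((((hB'.comp (measurable_fst.prodMk
      (measurable_fst.comp measurable_snd))).add (heB.comp (measurable_snd.comp measurable_snd)))).prodMk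
      (measurable_fst.comp measurable_snd))
  have hYm : Measurable Y := by
    rw [funext hY]
    exact (hA'.comp (measurable_fst.prodMk
      (measurable_fst.comp measurable_snd))).add (heA.comp (measurable_snd.comp measurable_snd))
  have hm2 : Measurable fun p : 𝒢 × (β × α) => shiftSum₂ ψB ψA (μB p.1) (μA p.1) p.2 := by
    unfold shiftSum₂; fun_prop
  have hm1 : Measurable fun p : 𝒢 × β => shiftSum ψB (μB p.1) p.2 := by
    unfold shiftSum; fun_prop
  have hne : ∀ g y, shiftSum ψB (μB g) y ≠ 0 := fun g y hq => by
    have := (Finset.sum_eq_zero_iff.1 hq) 0 (Finset.mem_univ _)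
    simp [hB0] at this
  have hnt : ∀ g y, shiftSum ψB (μB g) y ≠ ∞ := fun g y =>
    (ENNReal.sum_lt_top.2 fun w _ => (hBt _).lt_top).ne
  -- The candidate for the conditional density is joint over marginal; the factor `1 / M` is absent
  -- from both and cancels.
  have hr : Measurable fun q : γ × α =>
        shiftSum₂ ψB ψA (μB (e.symm q.1).2) (μA (e.symm q.1).2) ((e.symm q.1).1, q.2) /
          shiftSum ψB (μB (e.symm q.1).2) (e.symm q.1).1 := by
    have he : Measurable fun q : γ × α => e.symm q.1 := e.symm.measurable.comp measurable_fst
    exact (hm2.comp ((measurable_snd.comp he).prodMk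
      ((measurable_fst.comp he).prodMk measurable_snd))).div
      (hm1.comp ((measurable_snd.comp he).prodMk (measurable_fst.comp he)))
  have swap : ∀ f : Fin M × 𝒢 × Z → ℝ≥0∞, Measurable f →
      ∫⁻ ω, f ω ∂((messageLaw M).prod (Γ.prod ζ)) =
        ∫⁻ g, ∫⁻ w, ∫⁻ z, f (w, g, z) ∂ζ ∂(messageLaw M) ∂Γ := by
    intro f hf
    rw [lintegral_prod_symm _ hf.aemeasurable, lintegral_prod _ (by fun_prop)]
    refine lintegral_congr fun g => ?_
    exact lintegral_lintegral_swap (by fun_prop)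
  refine condDiffEntropy_of_withDensity hXm hYm hr ?_ (fun ω => ?_) hi
  swap
  · rw [← hℓ, hX, hY, e.symm_apply_apply]
  refine Measure.ext_of_lintegral _ fun F hF => ?_
  have hQ := (Measurable.lintegral_prod_right' (ν := volume) (hr.mul hF)).comp hXm
  simp only [Function.comp_def] at hQ
  rw [lintegral_map hF (by fun_prop), lintegral_withDensity_eq_lintegral_mul _ hr hF,
    lintegral_prod _ (hr.mul hF).aemeasurable, lintegral_map (Measurable.lintegral_prod_right' (hr.mul hF)) hXm,
    swap _ (by fun_prop), swap _ hQ]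
  refine lintegral_congr fun g => ?_
  simp only [hX, hY, Pi.mul_apply, MeasurableEquiv.symm_apply_apply]
  have hF1 : Measurable fun q : β × α => F (e (q.1, g), q.2) :=
    hF.comp ((e.measurable.comp (measurable_fst.prodMk measurable_const)).prodMk measurable_snd)
  have hm2g : Measurable (shiftSum₂ ψB ψA (μB g) (μA g)) := hm2.comp measurable_prodMk_left
  have hm1g : Measurable (shiftSum ψB (μB g)) := hm1.comp measurable_prodMk_left
  have hK : Measurable fun y : β => ∫⁻ u, shiftSum₂ ψB ψA (μB g) (μA g) (y, u) /
      shiftSum ψB (μB g) y * F (e (y, g), u) := by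
    apply Measurable.lintegral_prod_right'
      (f := fun q : β × α => shiftSum₂ ψB ψA (μB g) (μA g) q /
      shiftSum ψB (μB g) q.1 * F (e (q.1, g), q.2))
    fun_prop
  rw [lintegral_mixture heB heA hψB hψA h (μB g) (μA g) (fun q => F (e (q.1, g), q.2)) hF1,
    lintegral_mixture heB heA hψB hψA h (μB g) (μA g) (fun q => ∫⁻ u,
      shiftSum₂ ψB ψA (μB g) (μA g) (q.1, u) / shiftSum ψB (μB g) q.1 * F (e (q.1, g), u))
      (hK.comp measurable_fst), lintegral_shiftSum₂_fst hψB hψA hA _ _ _ hK]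
  congr 1
  rw [Measure.volume_eq_prod, lintegral_prod _ (by fun_prop)]
  refine lintegral_congr fun y => ?_
  rw [← lintegral_mul_const _ (by fun_prop)]
  refine lintegral_congr fun u => ?_
  rw [mul_right_comm, ENNReal.div_mul_cancel (hne _ _) (hnt _ _), mul_comm]

end Mixture

/-! ### Entropies of finite Gaussian mixtures -/

section GaussianMixture

variable {ι : Type*} {M : ℕ}

/-- The joint likelihood of the coordinates in `S`, when `y` is observed and `μ w` is the mean. -/
noncomputable def lik (S : Finset ι) (c y : ι → ℂ) : ℝ := ∏ i ∈ S, gaussDensity (y i - c i)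

/-- The density, up to the factor `1 / M`, of the coordinates in `S` of a Gaussian mixture. -/
noncomputable def mixDensity (μ : Fin M → ι → ℂ) (S : Finset ι) (y : ι → ℂ) : ℝ :=
  ∑ w, lik S (μ w) y

/-- The joint law of the message and the noise. -/
noncomputable def mixLaw (M : ℕ) [NeZero M] (ι : Type*) [Fintype ι] : Measure (Fin M × (ι → ℂ)) :=
  (messageLaw M).prod (Measure.pi fun _ => complexGaussian)

instance [Fintype ι] [NeZero M] : IsProbabilityMeasure (mixLaw M ι) := by unfold mixLaw; infer_instance

/-- The differential entropy, up to the additive constant `log M`, of the coordinates in `S` of a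
Gaussian mixture. -/
noncomputable def mixEntropy [Fintype ι] [NeZero M] (μ : Fin M → ι → ℂ) (S : Finset ι) : ℝ :=
  ∫ q, -Real.log (mixDensity μ S (μ q.1 + q.2)) ∂(mixLaw M ι)

lemma lik_pos (S : Finset ι) (c y : ι → ℂ) : 0 < lik S c y :=
  Finset.prod_pos fun _ _ => gaussDensity_pos _

lemma lik_le_one (S : Finset ι) (c y : ι → ℂ) : lik S c y ≤ 1 :=
  Finset.prod_le_one (fun _ _ => (gaussDensity_pos _).le) fun _ _ => (gaussDensity_le _).trans
    ((div_le_one Real.pi_pos).2 (by linarith [Real.pi_gt_three]))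

lemma lik_congr {S : Finset ι} {c c' y y' : ι → ℂ} (h : ∀ i ∈ S, y i - c i = y' i - c' i) :
    lik S c y = lik S c' y' :=
  Finset.prod_congr rfl fun i hi => by rw [h i hi]

lemma lik_insert [DecidableEq ι] {S : Finset ι} {a : ι} (ha : a ∉ S) (c y : ι → ℂ) :
    lik (insert a S) c y = lik S c y * gaussDensity (y a - c a) := by
  rw [lik, Finset.prod_insert ha, mul_comm, lik]

@[fun_prop]
lemma measurable_lik {δ : Type*} [MeasurableSpace δ] (S : Finset ι) {c y : δ → ι → ℂ}
    (hc : Measurable c) (hy : Measurable y) : Measurable fun x => lik S (c x) (y x) := by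
  unfold lik; fun_prop

lemma mixDensity_pos [NeZero M] (μ : Fin M → ι → ℂ) (S : Finset ι) (y : ι → ℂ) :
    0 < mixDensity μ S y :=
  Finset.sum_pos (fun _ _ => lik_pos _ _ _) ⟨0, Finset.mem_univ _⟩

lemma mixDensity_le (μ : Fin M → ι → ℂ) (S : Finset ι) (y : ι → ℂ) : mixDensity μ S y ≤ M := by
  refine (Finset.sum_le_card_nsmul _ _ 1 fun w _ => lik_le_one S (μ w) y).trans ?_
  simp

lemma lik_le_mixDensity (μ : Fin M → ι → ℂ) (S : Finset ι) (w : Fin M) (y : ι → ℂ) :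
    lik S (μ w) y ≤ mixDensity μ S y :=
  Finset.single_le_sum (f := fun w => lik S (μ w) y) (fun _ _ => (lik_pos _ _ _).le)
    (Finset.mem_univ w)

@[fun_prop]
lemma measurable_mixDensity {δ : Type*} [MeasurableSpace δ] (S : Finset ι)
    {μ : δ → Fin M → ι → ℂ} {y : δ → ι → ℂ} (hμ : Measurable μ) (hy : Measurable y) :
    Measurable fun x => mixDensity (μ x) S (y x) := by
  unfold mixDensity; fun_prop

lemma measurable_mean (μ : Fin M → ι → ℂ) :
    Measurable fun q : Fin M × (ι → ℂ) => μ q.1 + q.2 :=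
  ((measurable_of_finite μ).comp measurable_fst).add measurable_snd

/-- The posterior mean of a kernel. -/
noncomputable def posteriorMean (μ : Fin M → ι → ℂ) (S : Finset ι) (a : ι) (k : ℂ → ℝ)
    (y : ι → ℂ) (u : ℂ) : ℝ := (∑ w, lik S (μ w) y * k (u - μ w a)) / mixDensity μ S y

lemma posteriorMean_pos [NeZero M] (μ : Fin M → ι → ℂ) (S : Finset ι) (a : ι) {k : ℂ → ℝ}
    (hk : ∀ u, 0 < k u) (y : ι → ℂ) (u : ℂ) : 0 < posteriorMean μ S a k y u :=
  div_pos (Finset.sum_pos (fun _ _ => mul_pos (lik_pos _ _ _) (hk _)) ⟨0, Finset.mem_univ _⟩)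
    (mixDensity_pos _ _ _)

lemma measurable_posteriorMean (μ : Fin M → ι → ℂ) (S : Finset ι) (a : ι) {k : ℂ → ℝ}
    (hk : Measurable k) : Measurable (Function.uncurry (posteriorMean μ S a k)) := by
  unfold posteriorMean Function.uncurry; fun_prop

lemma posteriorMean_congr (μ : Fin M → ι → ℂ) (S : Finset ι) (a : ι) (k : ℂ → ℝ)
    {y y' : ι → ℂ} (u : ℂ) (h : ∀ i ∈ S, y i = y' i) :
    posteriorMean μ S a k y u = posteriorMean μ S a k y' u := by
  have : ∀ w, lik S (μ w) y = lik S (μ w) y' := fun w => lik_congr fun i hi => by rw [h i hi]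
  simp only [posteriorMean, mixDensity, this]

/-- If every translate of `k` has mass at most `C` for the weight `t`, so has the posterior mean. -/
lemma lintegral_posteriorMean_le [NeZero M] (μ : Fin M → ι → ℂ) (S : Finset ι) (a : ι) {k t : ℂ → ℝ}
    (hk : Measurable k) (hk0 : ∀ u, 0 ≤ k u) (ht : Measurable t) (ht0 : ∀ u, 0 ≤ t u) (C : ℝ≥0∞)
    (hC : ∀ c, ∫⁻ u, ENNReal.ofReal (k (u - c) * t u) ≤ C) (y : ι → ℂ) :
    ∫⁻ u, ENNReal.ofReal (posteriorMean μ S a k y u * t u) ≤ C := by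
  have hD := mixDensity_pos μ S y
  have e : ∀ u, ENNReal.ofReal (posteriorMean μ S a k y u * t u) =
      ∑ w, ENNReal.ofReal (lik S (μ w) y / mixDensity μ S y) *
        ENNReal.ofReal (k (u - μ w a) * t u) := by
    intro u
    rw [posteriorMean, div_mul_eq_mul_div, Finset.sum_mul, Finset.sum_div,
      ENNReal.ofReal_sum_of_nonneg fun w _ => div_nonneg (mul_nonneg (mul_nonneg (lik_pos _ _ _).le
        (hk0 _)) (ht0 _)) hD.le]
    refine Finset.sum_congr rfl fun w _ => ?_
    rw [← ENNReal.ofReal_mul (div_pos (lik_pos _ _ _) hD).le]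
    congr 1; ring
  simp only [e]
  rw [lintegral_finsetSum _ fun w _ => by fun_prop]
  calc _ ≤ ∑ w, ENNReal.ofReal (lik S (μ w) y / mixDensity μ S y) * C := by
        refine Finset.sum_le_sum fun w _ => ?_
        rw [lintegral_const_mul _ (by fun_prop)]
        gcongr
        exact hC _
    _ = C := by
        rw [← Finset.sum_mul, ← ENNReal.ofReal_sum_of_nonneg fun w _ =>
          (div_pos (lik_pos _ _ _) hD).le, ← Finset.sum_div]
        change ENNReal.ofReal (mixDensity μ S y / mixDensity μ S y) * C = C
        rw [div_self hD.ne', ENNReal.ofReal_one, one_mul]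

/-- The posterior mean of the noise density is the true conditional density of the coordinate `a`
given those in `S`. -/
lemma posteriorMean_gaussDensity [DecidableEq ι] (μ : Fin M → ι → ℂ) {S : Finset ι} {a : ι}
    (ha : a ∉ S) (y : ι → ℂ) :
    posteriorMean μ S a gaussDensity y (y a) = mixDensity μ (insert a S) y / mixDensity μ S y := by
  simp only [posteriorMean, mixDensity, lik_insert ha]

variable [Fintype ι]

/-- A bound for the logarithm of the mixture density along the mixture. -/
noncomputable def logBound (M : ℕ) (z : ι → ℂ) : ℝ :=
  Real.log M + Fintype.card ι * Real.log Real.pi + ∑ i, ‖z i‖ ^ 2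

/-- The mixture density lies between its own term `w`, where only the noise enters, and `M`. The
bound does not involve the means, so it serves as a dominating function uniformly in the channel. -/
lemma abs_log_mixDensity_le [NeZero M] (μ : Fin M → ι → ℂ) (S : Finset ι) (w : Fin M) (z : ι → ℂ) :
    |Real.log (mixDensity μ S (μ w + z))| ≤ logBound M z := by
  have hM : (0 : ℝ) ≤ Real.log M := Real.log_natCast_nonneg M
  have hpi : 0 ≤ Real.log Real.pi := Real.log_nonneg (by linarith [Real.pi_gt_three])
  have hs : 0 ≤ ∑ i, ‖z i‖ ^ 2 := Finset.sum_nonneg fun _ _ => sq_nonneg _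
  have h1 : Real.log (lik S (μ w) (μ w + z)) ≤ Real.log (mixDensity μ S (μ w + z)) :=
    Real.log_le_log (lik_pos _ _ _) (lik_le_mixDensity μ S w _)
  have h2 : Real.log (mixDensity μ S (μ w + z)) ≤ Real.log M :=
    Real.log_le_log (mixDensity_pos _ _ _) (mixDensity_le _ _ _)
  have h3 : Real.log (lik S (μ w) (μ w + z)) = -∑ i ∈ S, (‖z i‖ ^ 2 + Real.log Real.pi) := by
    rw [lik, Real.log_prod fun i _ => (gaussDensity_pos _).ne', ← Finset.sum_neg_distrib]
    refine Finset.sum_congr rfl fun i _ => ?_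
    rw [log_gaussDensity]
    simp only [Pi.add_apply, add_sub_cancel_left]
    ring
  have h4 : ∑ i ∈ S, (‖z i‖ ^ 2 + Real.log Real.pi) ≤ ∑ i, (‖z i‖ ^ 2 + Real.log Real.pi) :=
    Finset.sum_le_sum_of_subset_of_nonneg (Finset.subset_univ _) fun i _ _ => by positivity
  rw [Finset.sum_add_distrib (s := Finset.univ), Finset.sum_const, Finset.card_univ,
    nsmul_eq_mul] at h4
  have h5 : 0 ≤ (Fintype.card ι : ℝ) * Real.log Real.pi := by positivity
  unfold logBound
  rw [abs_le]
  constructor <;> linarith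

lemma integrable_norm_sq_noise [NeZero M] (i : ι) :
    Integrable (fun q : Fin M × (ι → ℂ) => ‖q.2 i‖ ^ 2) (mixLaw M ι) :=
  (integrable_comp_eval (μ := fun _ : ι => complexGaussian) (i := i)
    integrable_norm_sq_complexGaussian).comp_snd _

lemma integral_norm_sq_noise [NeZero M] (i : ι) :
    ∫ q, ‖q.2 i‖ ^ 2 ∂(mixLaw M ι) = ∫ z, ‖z‖ ^ 2 ∂complexGaussian := by
  rw [mixLaw, integral_fun_snd (f := fun z : ι → ℂ => ‖z i‖ ^ 2)]
  simp only [probReal_univ, one_smul]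
  exact integral_comp_eval (μ := fun _ : ι => complexGaussian) (i := i)
    (f := fun z : ℂ => ‖z‖ ^ 2) (by fun_prop)

lemma integrable_logBound [NeZero M] :
    Integrable (fun q : Fin M × (ι → ℂ) => logBound M q.2) (mixLaw M ι) :=
  (integrable_const _).add (integrable_finsetSum _ fun i _ => integrable_norm_sq_noise i)

lemma integrable_log_mixDensity [NeZero M] (μ : Fin M → ι → ℂ) (S : Finset ι) :
    Integrable (fun q => Real.log (mixDensity μ S (μ q.1 + q.2))) (mixLaw M ι) :=
  integrable_logBound.mono' ((measurable_mixDensity S measurable_const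
    (measurable_mean μ)).log.aestronglyMeasurable)
    (ae_of_all _ fun q => abs_log_mixDensity_le μ S q.1 q.2)

lemma abs_mixEntropy_le [NeZero M] (μ : Fin M → ι → ℂ) (S : Finset ι) :
    |mixEntropy μ S| ≤ ∫ q, logBound M q.2 ∂(mixLaw M ι) := by
  refine abs_integral_le_integral_abs.trans
    (integral_mono (integrable_log_mixDensity μ S).neg.abs integrable_logBound fun q => ?_)
  simp only [abs_neg]
  exact abs_log_mixDensity_le μ S q.1 q.2

lemma measurable_mixEntropy [NeZero M] {δ : Type*} [MeasurableSpace δ] {μ : δ → Fin M → ι → ℂ}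
    (hμ : Measurable μ) (S : Finset ι) : Measurable fun x => mixEntropy (μ x) S := by
  have : Measurable fun p : δ × (Fin M × (ι → ℂ)) => μ p.1 p.2.1 := by
    have h : Measurable fun p : (Fin M → ι → ℂ) × Fin M => p.1 p.2 :=
      measurable_from_prod_countable_left fun w => measurable_pi_apply w
    exact h.comp ((hμ.comp measurable_fst).prodMk (measurable_fst.comp measurable_snd))
  have h2 : Measurable fun p : δ × (Fin M × (ι → ℂ)) =>
      -Real.log (mixDensity (μ p.1) S (μ p.1 p.2.1 + p.2.2)) :=
    (measurable_mixDensity S (hμ.comp measurable_fst)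
      (this.add (measurable_snd.comp measurable_snd))).log.neg
  exact (h2.stronglyMeasurable.integral_prod_right' (ν := mixLaw M ι)).measurable

lemma integral_ratio_le_one [DecidableEq ι] [NeZero M] (μ : Fin M → ι → ℂ) {T : Finset ι} {a : ι} (ha : a ∉ T)
    (r : (ι → ℂ) → ℂ → ℝ) (hr : Measurable (Function.uncurry r)) (hr0 : ∀ y u, 0 < r y u)
    (hrT : ∀ y y' u, (∀ i ∈ T, y i = y' i) → r y u = r y' u)
    (hr1 : ∀ y, ∫⁻ u, ENNReal.ofReal (r y u) ≤ 1) :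
    ∫⁻ q, ENNReal.ofReal (r (μ q.1 + q.2) (μ q.1 a + q.2 a) * mixDensity μ T (μ q.1 + q.2) /
      mixDensity μ (insert a T) (μ q.1 + q.2)) ∂(mixLaw M ι) ≤ 1 := by
  -- As `r` sees only the coordinates in `T`, the value chosen outside `T` is immaterial.
  let ext (y : T → ℂ) (i : ι) : ℂ := if h : i ∈ T then y ⟨i, h⟩ else 0
  have hext : Measurable ext := by
    refine measurable_pi_iff.2 fun i => ?_
    by_cases h : i ∈ T
    · simp only [ext, h, dite_true]; fun_prop
    · simp only [ext, h, dite_false]; fun_prop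
  let ψA (u : ℂ) : ℝ≥0∞ := ENNReal.ofReal (gaussDensity u)
  let ψB (y : T → ℂ) : ℝ≥0∞ := ∏ i, ψA (y i)
  have hψA : Measurable ψA := by fun_prop
  have hψB : Measurable ψB := by fun_prop
  have hcg : complexGaussian = volume.withDensity ψA := rfl
  have : IsProbabilityMeasure (volume.withDensity ψA) := hcg ▸ inferInstance
  have hpi : (Measure.pi fun _ : T => complexGaussian) = volume.withDensity ψB :=
    pi_withDensity volume ψA hψA
  have hlaw := map_restrict_eval_pi complexGaussian T a ha
  rw [hpi, hcg] at hlaw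
  have hB1 : ∫⁻ y, ψB y = 1 := by
    have : (volume.withDensity ψB) Set.univ = 1 := by rw [← hpi]; exact measure_univ
    rwa [withDensity_apply _ MeasurableSet.univ, Measure.restrict_univ] at this
  have hψA0 : ∀ u, ψA u ≠ 0 := fun u => (ENNReal.ofReal_pos.2 (gaussDensity_pos u)).ne'
  have hr' : Measurable fun q : (T → ℂ) × ℂ => ENNReal.ofReal (r (ext q.1) q.2) :=
    (hr.comp ((hext.comp measurable_fst).prodMk measurable_snd)).ennreal_ofReal
  have key := lintegral_ratio_le_one (ζ := Measure.pi fun _ => volume.withDensity ψA)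
    (Finset.measurable_restrict T) (measurable_pi_apply a) hψB hψA hlaw hB1
    (fun y => Finset.prod_ne_zero_iff.2 fun i _ => hψA0 _) hψA0
    (fun y => ENNReal.prod_ne_top fun i _ => ENNReal.ofReal_ne_top) (fun u => ENNReal.ofReal_ne_top)
    (fun w => T.restrict (μ w)) (fun w => μ w a) _ hr' (fun y => hr1 (ext y))
  have e1 : ∀ c y : ι → ℂ, ψB (T.restrict y - T.restrict c) = ENNReal.ofReal (lik T c y) := by
    intro c y
    rw [lik, ENNReal.ofReal_prod_of_nonneg fun i _ => (gaussDensity_pos _).le, ← Finset.prod_coe_sort]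
    rfl
  have e2 : ∀ y : ι → ℂ, shiftSum ψB (fun w => T.restrict (μ w)) (T.restrict y) =
      ENNReal.ofReal (mixDensity μ T y) := by
    intro y
    rw [mixDensity, ENNReal.ofReal_sum_of_nonneg fun w _ => (lik_pos _ _ _).le]
    exact Finset.sum_congr rfl fun w _ => e1 _ _
  have e3 : ∀ y : ι → ℂ, shiftSum₂ ψB ψA (fun w => T.restrict (μ w)) (fun w => μ w a)
      (T.restrict y, y a) = ENNReal.ofReal (mixDensity μ (insert a T) y) := by
    intro y
    rw [mixDensity, ENNReal.ofReal_sum_of_nonneg fun w _ => (lik_pos _ _ _).le]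
    refine Finset.sum_congr rfl fun w _ => ?_
    rw [lik_insert ha, ENNReal.ofReal_mul (lik_pos _ _ _).le, ← e1]
  have e4 : ∀ y u, r (ext (T.restrict y)) u = r y u := fun y u => hrT _ _ _ fun i hi => by
    simp [ext, hi]
  have hm := measurable_mean μ
  have hrm : Measurable fun q : Fin M × (ι → ℂ) => r (μ q.1 + q.2) (μ q.1 a + q.2 a) :=
    hr.comp (hm.prodMk ((measurable_pi_apply a).comp hm))
  have hXm : Measurable fun q : Fin M × (ι → ℂ) => ENNReal.ofReal
      (r (μ q.1 + q.2) (μ q.1 a + q.2 a) * mixDensity μ T (μ q.1 + q.2) /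
        mixDensity μ (insert a T) (μ q.1 + q.2)) :=
    ((hrm.mul (by fun_prop)).div (by fun_prop)).ennreal_ofReal
  rw [mixLaw, lintegral_prod _ hXm.aemeasurable]
  refine le_of_eq_of_le (lintegral_congr fun w => lintegral_congr fun z => ?_) key
  change _ = ENNReal.ofReal (r (ext (T.restrict (μ w + z))) ((μ w + z) a)) *
    shiftSum ψB (fun w => T.restrict (μ w)) (T.restrict (μ w + z)) /
    shiftSum₂ ψB ψA (fun w => T.restrict (μ w)) (fun w => μ w a)
      (T.restrict (μ w + z), (μ w + z) a)
  rw [e2, e3, e4, ← ENNReal.ofReal_mul (hr0 _ _).le,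
    ENNReal.ofReal_div_of_pos (mixDensity_pos _ _ _)]
  rfl

/-- Gibbs' inequality for the entropy of one more coordinate. -/
lemma mixEntropy_insert_le [DecidableEq ι] [NeZero M] (μ : Fin M → ι → ℂ) {T : Finset ι} {a : ι}
    (ha : a ∉ T)
    (r : (ι → ℂ) → ℂ → ℝ) (hr : Measurable (Function.uncurry r)) (hr0 : ∀ y u, 0 < r y u)
    (hrT : ∀ y y' u, (∀ i ∈ T, y i = y' i) → r y u = r y' u)
    (hr1 : ∀ y, ∫⁻ u, ENNReal.ofReal (r y u) ≤ 1)
    {B : Fin M × (ι → ℂ) → ℝ} (hB : Integrable B (mixLaw M ι))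
    (h : ∀ q, -Real.log (r (μ q.1 + q.2) (μ q.1 a + q.2 a)) ≤ B q) :
    mixEntropy μ (insert a T) ≤ mixEntropy μ T + ∫ q, B q ∂(mixLaw M ι) := by
  set X : Fin M × (ι → ℂ) → ℝ := fun q =>
    r (μ q.1 + q.2) (μ q.1 a + q.2 a) * mixDensity μ T (μ q.1 + q.2) /
      mixDensity μ (insert a T) (μ q.1 + q.2) with hX
  have hm := measurable_mean μ
  have hX0 : ∀ q, 0 < X q := fun q =>
    div_pos (mul_pos (hr0 _ _) (mixDensity_pos _ _ _)) (mixDensity_pos _ _ _)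
  have hXm : Measurable X := by
    have : Measurable fun q : Fin M × (ι → ℂ) => r (μ q.1 + q.2) (μ q.1 a + q.2 a) :=
      hr.comp (hm.prodMk ((measurable_pi_apply a).comp hm))
    exact (this.mul (by fun_prop)).div (by fun_prop)
  have hX1 := integral_ratio_le_one μ ha r hr hr0 hrT hr1
  have hXi : Integrable X (mixLaw M ι) :=
    ⟨hXm.aestronglyMeasurable, (hasFiniteIntegral_iff_ofReal (ae_of_all _ fun q => (hX0 q).le)).2
      (hX1.trans_lt ENNReal.one_lt_top)⟩
  have hXle : ∫ q, X q ∂(mixLaw M ι) ≤ 1 := by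
    rw [integral_eq_lintegral_of_nonneg_ae (ae_of_all _ fun q => (hX0 q).le)
      hXm.aestronglyMeasurable]
    exact ENNReal.toReal_le_of_le_ofReal zero_le_one (by simpa using hX1)
  have hi1 := (integrable_log_mixDensity μ (insert a T)).neg
  have hi2 := (integrable_log_mixDensity μ T).neg
  -- Gibbs' inequality in pointwise form: `log X ≤ X - 1`, where `X` is the ratio of the test
  -- density to the true conditional density and has mean at most one.
  have hpt : ∀ q, -Real.log (mixDensity μ (insert a T) (μ q.1 + q.2)) ≤
      -Real.log (mixDensity μ T (μ q.1 + q.2)) + B q + (X q - 1) := by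
    intro q
    have h1 := Real.log_le_sub_one_of_pos (hX0 q)
    have h2 : Real.log (X q) = Real.log (r (μ q.1 + q.2) (μ q.1 a + q.2 a)) +
        Real.log (mixDensity μ T (μ q.1 + q.2)) -
        Real.log (mixDensity μ (insert a T) (μ q.1 + q.2)) := by
      rw [hX]
      simp only
      rw [Real.log_div (mul_pos (hr0 _ _) (mixDensity_pos _ _ _)).ne' (mixDensity_pos _ _ _).ne',
        Real.log_mul (hr0 _ _).ne' (mixDensity_pos _ _ _).ne']
    linarith [h q]
  have := integral_mono hi1 ((hi2.add hB).add (hXi.sub (integrable_const 1))) hpt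
  simp only [Pi.neg_apply, Pi.add_apply, Pi.sub_apply] at this
  rw [integral_add (by exact hi2.add hB) (by exact hXi.sub (integrable_const 1)),
    integral_add (by exact hi2) hB, integral_sub hXi (integrable_const 1)] at this
  simp only [integral_const, probReal_univ, one_smul] at this
  simp only [mixEntropy]
  linarith

/-- Conditioning on more coordinates does not increase the entropy. -/
lemma mixEntropy_insert_add_le [DecidableEq ι] [NeZero M] (μ : Fin M → ι → ℂ) {S T : Finset ι}
    {a : ι} (hST : S ⊆ T) (ha : a ∉ T) :
    mixEntropy μ (insert a T) + mixEntropy μ S ≤ mixEntropy μ (insert a S) + mixEntropy μ T := by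
  have haS : a ∉ S := fun h => ha (hST h)
  have i1 := integrable_log_mixDensity μ (insert a S)
  have i2 := integrable_log_mixDensity μ S
  -- The conditional density given `S` is an admissible test density given the larger set `T`.
  have := mixEntropy_insert_le μ ha (posteriorMean μ S a gaussDensity)
    (measurable_posteriorMean μ S a measurable_gaussDensity)
    (posteriorMean_pos μ S a gaussDensity_pos)
    (fun y y' u h => posteriorMean_congr _ _ _ _ _ fun i hi => h i (hST hi))
    (fun y => by
      have := lintegral_posteriorMean_le μ S a measurable_gaussDensity
        (fun u => (gaussDensity_pos u).le) (t := fun _ => 1) (by fun_prop) (fun _ => zero_le_one) 1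
        (fun c => by
          simp only [mul_one]
          have := lintegral_add_right_eq_self (μ := (volume : Measure ℂ))
            (fun u => ENNReal.ofReal (gaussDensity u)) (-c)
          simp only [← sub_eq_add_neg] at this
          rw [this, lintegral_gaussDensity]) y
      simpa only [mul_one] using this)
    (B := fun q => -Real.log (mixDensity μ (insert a S) (μ q.1 + q.2)) +
      Real.log (mixDensity μ S (μ q.1 + q.2))) (i1.neg.add i2)
    (fun q => by
      have := posteriorMean_gaussDensity μ haS (μ q.1 + q.2)
      simp only [Pi.add_apply] at this
      rw [this, Real.log_div (mixDensity_pos _ _ _).ne' (mixDensity_pos _ _ _).ne']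
      linarith)
  rw [integral_add (by exact i1.neg) i2] at this
  have e : mixEntropy μ S = -∫ q, Real.log (mixDensity μ S (μ q.1 + q.2)) ∂(mixLaw M ι) := by
    rw [mixEntropy, integral_neg]
  have e2 : mixEntropy μ (insert a S) =
    ∫ q, -Real.log (mixDensity μ (insert a S) (μ q.1 + q.2)) ∂(mixLaw M ι) := rfl
  linarith

end GaussianMixture

/-! ### Two kernels on the complex plane -/

/-- In polar coordinates the radial integrand has the primitive `-(1 + r²)^(-δ) / (2δ)`. -/
lemma integral_one_add_norm_sq_rpow {δ : ℝ} (hδ : 0 < δ) :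
    ∫ u : ℂ, (1 + ‖u‖ ^ 2) ^ (-(1 + δ)) = Real.pi / δ := by
  have hd : ∀ r ∈ Set.Ici (0 : ℝ), HasDerivAt (fun r : ℝ => -(1 + r ^ 2) ^ (-δ) / (2 * δ))
      (r * (1 + |r| ^ 2) ^ (-(1 + δ))) r := by
    intro r _
    have h1 : HasDerivAt (fun r : ℝ => 1 + r ^ 2) (2 * r) r := by
      simpa using (hasDerivAt_pow 2 r).const_add 1
    have h2 := ((h1.rpow_const (p := -δ) (Or.inl (by positivity))).neg).div_const (2 * δ)
    convert! h2 using 1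
    rw [sq_abs, show -δ - 1 = -(1 + δ) by ring]
    field_simp
  have ht : Tendsto (fun r : ℝ => -(1 + r ^ 2) ^ (-δ) / (2 * δ)) atTop (nhds 0) := by
    have h1 : Tendsto (fun r : ℝ => 1 + r ^ 2) atTop atTop :=
      tendsto_atTop_add_const_left _ _ (tendsto_pow_atTop (by norm_num))
    have h2 := ((tendsto_rpow_neg_atTop hδ).comp h1).neg.div_const (2 * δ)
    simpa using h2
  have hr := integral_Ioi_of_hasDerivAt_of_nonneg' hd
    (fun r (hr : 0 < r) => by positivity) ht
  rw [← Complex.integral_comp_polarCoord_symm, polarCoord_target]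
  simp_rw [Complex.norm_polarCoord_symm, smul_eq_mul]
  have := setIntegral_prod_mul (μ := volume) (ν := volume)
    (fun r : ℝ => r * (1 + |r| ^ 2) ^ (-(1 + δ))) (fun _ : ℝ => (1 : ℝ))
    (Set.Ioi 0) (Set.Ioo (-Real.pi) Real.pi)
  simp only [mul_one] at this
  rw [Measure.volume_eq_prod, this, hr]
  simp [Real.volume_real_Ioo_of_le (show -Real.pi ≤ Real.pi by linarith [Real.pi_pos])]
  field_simp
  ring

lemma lintegral_one_add_norm_sq_rpow {δ : ℝ} (hδ : 0 < δ) :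
    ∫⁻ u : ℂ, ENNReal.ofReal ((1 + ‖u‖ ^ 2) ^ (-(1 + δ))) = ENNReal.ofReal (Real.pi / δ) := by
  have h := integral_one_add_norm_sq_rpow hδ
  have hi : Integrable fun u : ℂ => (1 + ‖u‖ ^ 2) ^ (-(1 + δ)) := by
    by_contra h'
    rw [integral_undef h'] at h
    exact (div_pos Real.pi_pos hδ).ne h
  rw [← h, ofReal_integral_eq_lintegral_ofReal hi (ae_of_all _ fun u => by positivity)]

/-- The Cauchy type kernel `1 / (1 + |u|²)`. -/
noncomputable def cauchyKernel (u : ℂ) : ℝ := (1 + ‖u‖ ^ 2)⁻¹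

lemma cauchyKernel_pos (u : ℂ) : 0 < cauchyKernel u := by unfold cauchyKernel; positivity

@[fun_prop]
lemma measurable_cauchyKernel : Measurable cauchyKernel := by unfold cauchyKernel; fun_prop

/-- Replacing the larger of the two bases by the smaller one increases the product and leaves a
single power. -/
lemma cauchyKernel_mul_le {δ : ℝ} (hδ : 0 < δ) (u v : ℂ) :
    cauchyKernel u * (1 + ‖v‖ ^ 2) ^ (-δ) ≤
      (1 + ‖u‖ ^ 2) ^ (-(1 + δ)) + (1 + ‖v‖ ^ 2) ^ (-(1 + δ)) := by
  have hu : 0 < 1 + ‖u‖ ^ 2 := by positivity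
  have hv : 0 < 1 + ‖v‖ ^ 2 := by positivity
  rw [neg_add, Real.rpow_add hu, Real.rpow_add hv, Real.rpow_neg_one, Real.rpow_neg_one,
    cauchyKernel]
  rcases le_total (1 + ‖u‖ ^ 2) (1 + ‖v‖ ^ 2) with h | h
  · have := Real.rpow_le_rpow_of_nonpos hu h (neg_nonpos.2 hδ.le)
    refine le_add_of_le_of_nonneg ?_ (by positivity)
    gcongr
  · refine le_add_of_nonneg_of_le (by positivity) ?_
    gcongr

/-- The kernel alone has logarithmically divergent mass. The weight is centred at the origin, not at
`c`, so that it factors out of a posterior mean; the bound is uniform in `c`. -/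
lemma lintegral_cauchyKernel_mul_le {δ : ℝ} (hδ : 0 < δ) (c : ℂ) :
    ∫⁻ u : ℂ, ENNReal.ofReal (cauchyKernel (u - c) * (1 + ‖u‖ ^ 2) ^ (-δ)) ≤
      ENNReal.ofReal (2 * Real.pi / δ) := by
  have h := lintegral_one_add_norm_sq_rpow hδ
  have h1 := lintegral_add_right_eq_self (μ := (volume : Measure ℂ))
    (fun u => ENNReal.ofReal ((1 + ‖u‖ ^ 2) ^ (-(1 + δ)))) (-c)
  simp only [← sub_eq_add_neg] at h1
  calc _ ≤ ∫⁻ u : ℂ, (ENNReal.ofReal ((1 + ‖u - c‖ ^ 2) ^ (-(1 + δ))) +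
        ENNReal.ofReal ((1 + ‖u‖ ^ 2) ^ (-(1 + δ)))) := by
        refine lintegral_mono fun u => ?_
        rw [← ENNReal.ofReal_add (by positivity) (by positivity)]
        exact ENNReal.ofReal_le_ofReal (cauchyKernel_mul_le hδ _ _)
    _ = ENNReal.ofReal (2 * Real.pi / δ) := by
        rw [lintegral_add_left (by fun_prop), h1, h, ← ENNReal.ofReal_add (by positivity)
          (by positivity)]
        congr 1; ring

/-! ### Generic linear forms -/

lemma lintegral_comp_mul_left_complex (v : ℂ) (hv : v ≠ 0) (F : ℂ → ℝ≥0∞) (hF : Measurable F) :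
    ∫⁻ u, F (u * v) = ENNReal.ofReal (‖v‖ ^ 2)⁻¹ * ∫⁻ u, F u := by
  have hdet : LinearMap.det (LinearMap.mulRight ℝ v) = ‖v‖ ^ 2 := by
    have := Algebra.norm_complex_apply v
    rw [Algebra.norm_apply, Complex.normSq_eq_norm_sq] at this
    rw [← this]
    congr 1
    ext
    simp [mul_comm]
  have hdet0 : LinearMap.det (LinearMap.mulRight ℝ v) ≠ 0 := by rw [hdet]; positivity
  have h : (volume : Measure ℂ).map (fun u => u * v) = ENNReal.ofReal (‖v‖ ^ 2)⁻¹ • volume := by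
    have := Measure.map_linearMap_addHaar_eq_smul_addHaar (μ := (volume : Measure ℂ)) hdet0
    rwa [hdet, abs_of_pos (by positivity)] at this
  rw [← lintegral_map hF (by fun_prop), h, lintegral_smul_measure, smul_eq_mul]

lemma IsChannelLaw.fmax_nonneg {dmax fmax : ℝ} {ν : Measure ℂ} (h : IsChannelLaw dmax fmax ν) :
    0 ≤ fmax := by
  obtain ⟨φ, -, hφ, -⟩ := h.density
  exact (hφ 0).1.trans (hφ 0).2

/-- Multiplication by `v` spreads a density bounded by `fmax` to one bounded by `fmax / ‖v‖²`, and
the Gaussian has mass one. With the factor on the left, `v = 0` needs no exclusion. -/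
lemma IsChannelLaw.lintegral_gaussDensity_le {dmax fmax : ℝ} {ν : Measure ℂ}
    (h : IsChannelLaw dmax fmax ν) (c v : ℂ) :
    ENNReal.ofReal (‖v‖ ^ 2) * ∫⁻ u, ENNReal.ofReal (gaussDensity (c + u * v)) ∂ν ≤
      ENNReal.ofReal fmax := by
  rcases eq_or_ne v 0 with rfl | hv
  · simp
  obtain ⟨φ, hφm, hφ, hν⟩ := h.density
  rw [hν, lintegral_withDensity_eq_lintegral_mul _ (by fun_prop) (by fun_prop)]
  have h1 := lintegral_comp_mul_left_complex v hv
    (fun u => ENNReal.ofReal (gaussDensity (c + u))) (by fun_prop)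
  rw [lintegral_add_left_eq_self (μ := (volume : Measure ℂ))
    (fun u => ENNReal.ofReal (gaussDensity u)) c, lintegral_gaussDensity, mul_one] at h1
  have hv2 : 0 < ‖v‖ ^ 2 := by positivity
  calc _ ≤ ENNReal.ofReal (‖v‖ ^ 2) *
        ∫⁻ u, ENNReal.ofReal fmax * ENNReal.ofReal (gaussDensity (c + u * v)) := by
        gcongr with u
        exact mul_le_mul_left (ENNReal.ofReal_le_ofReal (hφ u).2) _
    _ = ENNReal.ofReal fmax := by
        rw [lintegral_const_mul _ (by fun_prop), h1, mul_left_comm,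
          ← ENNReal.ofReal_mul hv2.le, mul_inv_cancel₀ hv2.ne', ENNReal.ofReal_one, mul_one]

/-- Resampling one coordinate preserves the product law. This isolates a coordinate as an
independent variable without splitting the index set. -/
lemma measurePreserving_update {ι E : Type*} [Fintype ι] [DecidableEq ι] [MeasurableSpace E]
    (ρ : Measure E) [IsProbabilityMeasure ρ] (a : ι) :
    MeasurePreserving (fun p : (ι → E) × E => Function.update p.1 a p.2)
      ((Measure.pi fun _ : ι => ρ).prod ρ) (Measure.pi fun _ : ι => ρ) := by
  have hm : Measurable fun p : (ι → E) × E => Function.update p.1 a p.2 := by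
    refine measurable_pi_iff.2 fun i => ?_
    by_cases h : i = a
    · subst h; simpa using measurable_snd
    · simp only [Function.update_of_ne h]; fun_prop
  refine ⟨hm, (Measure.pi_eq fun s hs => ?_).symm⟩
  rw [Measure.map_apply hm (MeasurableSet.univ_pi hs)]
  have : (fun p : (ι → E) × E => Function.update p.1 a p.2) ⁻¹' Set.univ.pi s =
      (Set.univ.pi (Function.update s a Set.univ)) ×ˢ s a := by
    ext p
    simp only [Set.mem_preimage, Set.mem_univ_pi, Set.mem_prod]
    constructor
    · intro h
      refine ⟨fun i => ?_, by simpa using h a⟩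
      by_cases hi : i = a
      · subst hi; simp
      · simpa [hi] using h i
    · rintro ⟨h1, h2⟩ i
      by_cases hi : i = a
      · subst hi; simpa using h2
      · simpa [hi] using h1 i
  rw [this, Measure.prod_prod, Measure.pi_pi, ← Finset.mul_prod_erase _ _ (Finset.mem_univ a),
    ← Finset.mul_prod_erase _ (fun i => ρ (s i)) (Finset.mem_univ a)]
  simp only [Function.update_self, measure_univ, one_mul]
  rw [mul_comm]
  congr 1
  refine Finset.prod_congr rfl fun i hi => ?_
  rw [Function.update_of_ne (Finset.ne_of_mem_erase hi)]

/-- The density of the noisy observation of a random linear form of `v`. -/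
lemma IsChannelLaw.integral_gaussDensity_le {dmax fmax : ℝ} {ν : Measure ℂ}
    (h : IsChannelLaw dmax fmax ν) {m : ℕ} (K : ℝ) (hK : 0 ≤ K) (c : ℂ) (v : Fin m → ℂ) :
    ∫ g, gaussDensity (c + ∑ i, g i * v i) ∂(Measure.pi fun _ : Fin m => ν) ≤
      (1 / Real.pi + K * fmax) / (1 + K * ‖v‖ ^ 2) := by
  have := h.isProbabilityMeasure
  have hf := h.fmax_nonneg
  have hm : Measurable fun g : Fin m → ℂ => gaussDensity (c + ∑ i, g i * v i) := by fun_prop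
  set J := ∫ g, gaussDensity (c + ∑ i, g i * v i) ∂(Measure.pi fun _ : Fin m => ν) with hJ
  have hJ0 : 0 ≤ J := integral_nonneg fun g => (gaussDensity_pos _).le
  have hJ1 : J ≤ 1 / Real.pi := by
    have : Integrable (fun g : Fin m → ℂ => gaussDensity (c + ∑ i, g i * v i))
        (Measure.pi fun _ : Fin m => ν) := by
      refine Integrable.of_bound hm.aestronglyMeasurable (1 / Real.pi) (ae_of_all _ fun g => ?_)
      rw [Real.norm_of_nonneg (gaussDensity_pos _).le]
      exact gaussDensity_le _
    refine (integral_mono this (integrable_const _) fun g => gaussDensity_le _).trans ?_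
    simp
  have hJ2 : ‖v‖ ^ 2 * J ≤ fmax := by
    rcases isEmpty_or_nonempty (Fin m) with hm0 | hm0
    · have : v = 0 := Subsingleton.elim _ _
      simpa [this] using hf
    -- Only the coefficient of the largest entry of `v` is averaged; the other terms join the shift
    -- `c`. Since `‖v‖` is the sup norm, nothing is lost.
    obtain ⟨i, hi⟩ := Finite.exists_max fun i => ‖v i‖
    have hvi : ‖v‖ = ‖v i‖ :=
      le_antisymm ((pi_norm_le_iff_of_nonneg (norm_nonneg _)).2 hi) (norm_le_pi_norm v i)
    have hm2 : Measurable fun p : (Fin m → ℂ) × ℂ => ENNReal.ofReal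
        (gaussDensity (c + ∑ k, Function.update p.1 i p.2 k * v k)) :=
      (hm.comp (measurePreserving_update ν i).measurable).ennreal_ofReal
    have hl : ENNReal.ofReal (‖v i‖ ^ 2) * ∫⁻ g, ENNReal.ofReal
        (gaussDensity (c + ∑ i, g i * v i)) ∂(Measure.pi fun _ : Fin m => ν) ≤
        ENNReal.ofReal fmax := by
      rw [← (measurePreserving_update ν i).lintegral_comp (by fun_prop),
        lintegral_prod _ hm2.aemeasurable,
        ← lintegral_const_mul']
      · refine (lintegral_mono (g := fun _ => ENNReal.ofReal fmax) fun g => ?_).trans (by simp)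
        refine le_of_eq_of_le ?_ (h.lintegral_gaussDensity_le
          (c + ∑ k ∈ Finset.univ.erase i, g k * v k) (v i))
        congr 1
        refine lintegral_congr fun u => ?_
        rw [← Finset.add_sum_erase _ _ (Finset.mem_univ i)]
        simp only [Function.update_self]
        rw [Finset.sum_congr rfl fun k hk => by
          rw [Function.update_of_ne (Finset.ne_of_mem_erase hk)]]
        congr 2
        ring
      · exact ENNReal.ofReal_ne_top
    have hJl : ENNReal.ofReal J = ∫⁻ g, ENNReal.ofReal
        (gaussDensity (c + ∑ i, g i * v i)) ∂(Measure.pi fun _ : Fin m => ν) := by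
      refine ofReal_integral_eq_lintegral_ofReal ?_ (ae_of_all _ fun g => (gaussDensity_pos _).le)
      refine Integrable.of_bound hm.aestronglyMeasurable (1 / Real.pi) (ae_of_all _ fun g => ?_)
      rw [Real.norm_of_nonneg (gaussDensity_pos _).le]
      exact gaussDensity_le _
    rw [← hJl, ← hvi, ← ENNReal.ofReal_mul (sq_nonneg _)] at hl
    exact (ENNReal.ofReal_le_ofReal_iff hf).1 hl
  -- The bounds `J ≤ 1/π` and `‖v‖² J ≤ fmax` are added with weights `1` and `K`.
  rw [le_div_iff₀ (by positivity)]
  nlinarith [mul_le_mul_of_nonneg_left hJ2 hK]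

/-! ### A generic linear form has the largest entropy -/

section Alignment

variable {ι : Type*} [Fintype ι] [DecidableEq ι] {M m : ℕ}

/-- The means in which the coordinate `a` is replaced by the linear form `g` of the inputs `x`. -/
noncomputable def setMean (μ : Fin M → ι → ℂ) (a : ι) (x : Fin M → Fin m → ℂ) (g : Fin m → ℂ)
    (w : Fin M) : ι → ℂ := Function.update (μ w) a (∑ i, g i * x w i)

omit [Fintype ι] in
lemma measurable_setMean (μ : Fin M → ι → ℂ) (a : ι) (x : Fin M → Fin m → ℂ) :
    Measurable (setMean μ a x) := by
  refine measurable_pi_iff.2 fun w => measurable_pi_iff.2 fun i => ?_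
  unfold setMean
  by_cases h : i = a
  · subst h; simp only [Function.update_self]; fun_prop
  · simp only [Function.update_of_ne h]; fun_prop

omit [Fintype ι] in
-- The random row `g` enters only through the coordinate `a`, and there only through differences of
-- inputs; the weights `lik D` do not depend on it.
lemma mixDensity_setMean (μ : Fin M → ι → ℂ) {D : Finset ι} {a : ι} (ha : a ∉ D)
    (x : Fin M → Fin m → ℂ) (g : Fin m → ℂ) (w : Fin M) (z : ι → ℂ) :
    mixDensity (setMean μ a x g) (insert a D) (setMean μ a x g w + z) =
      ∑ w', lik D (μ w') (μ w + z) *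
        gaussDensity (z a + ∑ i, g i * (x w - x w') i) := by
  refine Finset.sum_congr rfl fun w' _ => ?_
  rw [lik_insert ha]
  congr 1
  · refine lik_congr fun i hi => ?_
    have hia : i ≠ a := fun h => ha (h ▸ hi)
    simp [setMean, hia]
  · congr 1
    simp only [setMean, Pi.add_apply, Function.update_self, Pi.sub_apply, mul_sub,
      Finset.sum_sub_distrib]
    ring

lemma norm_linearForm_sq_le {d : ℝ} {g x : Fin m → ℂ} (hg : ∀ i, ‖g i‖ ≤ d) :
    ‖∑ i, g i * x i‖ ^ 2 ≤ (m * d) ^ 2 * ‖x‖ ^ 2 := by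
  rw [← mul_pow]
  refine pow_le_pow_left₀ (norm_nonneg _) ?_ 2
  refine (norm_sum_le _ _).trans ((Finset.sum_le_card_nsmul _ _ (d * ‖x‖) fun i _ => ?_).trans ?_)
  · rw [norm_mul]
    have := (norm_nonneg _).trans (hg i)
    exact mul_le_mul (hg i) (norm_le_pi_norm x i) (norm_nonneg _) this
  · simp [mul_assoc]

/-- From `|z + c|² ≤ 2|z|² + 2|c|²` one gets `1 + |s|² ≤ 2 (1 + |z|²)(1 + K v²)`. Thus the kernel at
`b` dominates, up to a noise factor, the bound for the averaged Gaussian at `a`. -/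
lemma cauchyKernel_add_ge {K : ℝ} (hK : 0 ≤ K) {s z c : ℂ} {v : ℝ} (hc : ‖c‖ ^ 2 ≤ K * v ^ 2)
    (hs : s = z + c) : (1 + K * v ^ 2)⁻¹ ≤ 2 * (1 + ‖z‖ ^ 2) * cauchyKernel s := by
  have h1 : ‖s‖ ^ 2 ≤ 2 * ‖z‖ ^ 2 + 2 * ‖c‖ ^ 2 := by
    have h2 : ‖s‖ ≤ ‖z‖ + ‖c‖ := hs ▸ norm_add_le _ _
    nlinarith [norm_nonneg s, sq_nonneg (‖z‖ - ‖c‖), norm_nonneg z, norm_nonneg c]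
  have h3 : 0 ≤ K * v ^ 2 := by positivity
  rw [cauchyKernel, ← div_eq_mul_inv, inv_eq_one_div, div_le_div_iff₀ (by positivity) (by positivity)]
  nlinarith [mul_nonneg h3 (sq_nonneg ‖z‖)]

/-- Jensen's inequality for the logarithm of a bounded positive function. -/
lemma integral_log_le {Ω : Type*} [MeasurableSpace Ω] {P : Measure Ω} [IsProbabilityMeasure P]
    {u : Ω → ℝ} (hu : Integrable u P) (hlu : Integrable (fun ω => Real.log (u ω)) P)
    (hu0 : ∀ ω, 0 < u ω) {A : ℝ} (hA : 0 < A) (h : ∫ ω, u ω ∂P ≤ A) :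
    ∫ ω, Real.log (u ω) ∂P ≤ Real.log A := by
  have hpt : ∀ ω, Real.log (u ω) ≤ Real.log A + (u ω / A - 1) := by
    intro ω
    have := Real.log_le_sub_one_of_pos (div_pos (hu0 ω) hA)
    rw [Real.log_div (hu0 ω).ne' hA.ne'] at this
    linarith
  have := integral_mono hlu ((integrable_const _).add ((hu.div_const A).sub (integrable_const 1))) hpt
  simp only [Pi.add_apply, Pi.sub_apply] at this
  rw [integral_add (integrable_const _) (by exact (hu.div_const A).sub (integrable_const 1)),
    integral_sub (hu.div_const A) (integrable_const 1), integral_div] at this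
  simp only [integral_const, probReal_univ, one_smul] at this
  have := (div_le_one hA).2 h
  linarith

variable [NeZero M]

lemma integrable_log_mixDensity_setMean (ρ : Measure (Fin m → ℂ)) [IsProbabilityMeasure ρ]
    (μ : Fin M → ι → ℂ) (a : ι) (x : Fin M → Fin m → ℂ) (S : Finset ι) :
    Integrable (fun p : (Fin M × (ι → ℂ)) × (Fin m → ℂ) => -Real.log
      (mixDensity (setMean μ a x p.2) S (setMean μ a x p.2 p.1.1 + p.1.2)))
      ((mixLaw M ι).prod ρ) := by
  have hs := measurable_setMean μ a x
  have h1 : Measurable fun p : (Fin M × (ι → ℂ)) × (Fin m → ℂ) => setMean μ a x p.2 p.1.1 := by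
    have h : Measurable fun p : (Fin M → ι → ℂ) × Fin M => p.1 p.2 :=
      measurable_from_prod_countable_left fun w => measurable_pi_apply w
    exact h.comp ((hs.comp measurable_snd).prodMk (measurable_fst.comp measurable_fst))
  refine (integrable_logBound.comp_fst ρ).mono' (Measurable.aestronglyMeasurable ?_)
    (ae_of_all _ fun p => ?_)
  · exact (measurable_mixDensity S (hs.comp measurable_snd)
      (h1.add (measurable_snd.comp measurable_fst))).log.neg
  · rw [norm_neg]; exact abs_log_mixDensity_le _ S p.1.1 p.1.2

/-- The mean of the logarithmic density of a generic linear form, for given message and noise. -/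
lemma IsChannelLaw.neg_log_le {dmax fmax : ℝ} {ν : Measure ℂ} (h : IsChannelLaw dmax fmax ν)
    {K : ℝ} (hK : 0 ≤ K) (μ : Fin M → ι → ℂ) {D : Finset ι} {a : ι} (ha : a ∉ D)
    (x : Fin M → Fin m → ℂ) (w : Fin M) (z : ι → ℂ) :
    -Real.log (∑ w', lik D (μ w') (μ w + z) * (1 + K * ‖x w - x w'‖ ^ 2)⁻¹) ≤
      Real.log (1 / Real.pi + K * fmax) + ∫ g, -Real.log
        (mixDensity (setMean μ a x g) (insert a D) (setMean μ a x g w + z))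
        ∂(Measure.pi fun _ : Fin m => ν) := by
  have := h.isProbabilityMeasure
  have hC : 0 < 1 / Real.pi + K * fmax := by
    have := mul_nonneg hK h.fmax_nonneg
    positivity
  set A := ∑ w', lik D (μ w') (μ w + z) * (1 + K * ‖x w - x w'‖ ^ 2)⁻¹ with hA
  have hA0 : 0 < A := Finset.sum_pos (fun w' _ => mul_pos (lik_pos _ _ _) (by positivity))
    ⟨0, Finset.mem_univ _⟩
  have hi : ∀ w', Integrable (fun g : Fin m → ℂ =>
      gaussDensity (z a + ∑ i, g i * (x w - x w') i)) (Measure.pi fun _ : Fin m => ν) := fun w' => by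
    refine Integrable.of_bound (Measurable.aestronglyMeasurable (by fun_prop)) (1 / Real.pi)
      (ae_of_all _ fun g => ?_)
    rw [Real.norm_of_nonneg (gaussDensity_pos _).le]
    exact gaussDensity_le _
  have hmu : Integrable (fun g => mixDensity (setMean μ a x g) (insert a D)
      (setMean μ a x g w + z)) (Measure.pi fun _ : Fin m => ν) := by
    simp only [mixDensity_setMean μ ha]
    exact integrable_finsetSum _ fun w' _ => (hi w').const_mul _
  have hlog : Integrable (fun g => Real.log (mixDensity (setMean μ a x g) (insert a D)
      (setMean μ a x g w + z))) (Measure.pi fun _ : Fin m => ν) := by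
    refine Integrable.of_bound (Measurable.aestronglyMeasurable ?_) (logBound M z)
      (ae_of_all _ fun g => abs_log_mixDensity_le _ _ _ _)
    simp only [mixDensity_setMean μ ha]
    fun_prop
  -- Averaging over `g` acts on each candidate message separately; Jensen then moves the logarithm
  -- outside.
  have hint : ∫ g, mixDensity (setMean μ a x g) (insert a D) (setMean μ a x g w + z)
      ∂(Measure.pi fun _ : Fin m => ν) ≤ (1 / Real.pi + K * fmax) * A := by
    simp only [mixDensity_setMean μ ha]
    rw [integral_finsetSum _ fun w' _ => (hi w').const_mul _, hA, Finset.mul_sum]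
    refine Finset.sum_le_sum fun w' _ => ?_
    rw [integral_const_mul, mul_left_comm]
    refine mul_le_mul_of_nonneg_left ?_ (lik_pos _ _ _).le
    rw [← div_eq_mul_inv]
    exact h.integral_gaussDensity_le K hK (z a) (x w - x w')
  have := integral_log_le hmu hlog (fun g => mixDensity_pos _ _ _) (mul_pos hC hA0) hint
  rw [Real.log_mul hC.ne' hA0.ne'] at this
  rw [integral_neg]
  linarith

/-- The constant in the comparison of a linear form with a generic one: `p` is the power and `K`
bounds the square of the norm of the form. -/
noncomputable def alignConst (K fmax δ p : ℝ) : ℝ :=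
  Real.log (2 * Real.pi / δ) + Real.log (1 / Real.pi + K * fmax) + Real.log 2 +
    ∫ z, ‖z‖ ^ 2 ∂complexGaussian +
    δ * (Real.log (1 + p) + (1 + 2 * ∫ z, ‖z‖ ^ 2 ∂complexGaussian) / (1 + p))

/-- The comparison of a given linear form (coordinate `b`) with a generic one (coordinate `a`). -/
lemma IsChannelLaw.mixEntropy_insert_le {dmax fmax : ℝ} {ν : Measure ℂ}
    (h : IsChannelLaw dmax fmax ν) {δ p : ℝ} (hδ : 0 < δ) (hp : 0 < p) (μ : Fin M → ι → ℂ)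
    {D : Finset ι} {a b : ι} (ha : a ∉ D) (hb : b ∉ D) (x : Fin M → Fin m → ℂ) (g : Fin m → ℂ)
    (hg : ∀ i, ‖g i‖ ≤ dmax) (hμ : ∀ w, μ w b = ∑ i, g i * x w i) :
    mixEntropy μ (insert b D) ≤
      ∫ g', mixEntropy (setMean μ a x g') (insert a D) ∂(Measure.pi fun _ : Fin m => ν) +
      (alignConst ((m * dmax) ^ 2) fmax δ p +
      δ * (2 * (m * dmax) ^ 2 / (1 + p)) * ∫ w, ‖x w‖ ^ 2 ∂(messageLaw M)) := by
  have := h.isProbabilityMeasure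
  set K : ℝ := (m * dmax) ^ 2 with hKdef
  have hK : 0 ≤ K := sq_nonneg _
  have hC : 0 < 1 / Real.pi + K * fmax := by
    have := mul_nonneg hK h.fmax_nonneg
    positivity
  have hc0 : 0 < δ / (2 * Real.pi) := by positivity
  let J : Fin M × (ι → ℂ) → ℝ := fun q => ∫ g', -Real.log
    (mixDensity (setMean μ a x g') (insert a D) (setMean μ a x g' q.1 + q.2))
      ∂(Measure.pi fun _ : Fin m => ν)
  have hJp := integrable_log_mixDensity_setMean (Measure.pi fun _ : Fin m => ν) μ a x (insert a D)
  have hJ : Integrable J (mixLaw M ι) := hJp.integral_prod_left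
  have hJint : ∫ q, J q ∂(mixLaw M ι) = ∫ g', mixEntropy (setMean μ a x g') (insert a D)
      ∂(Measure.pi fun _ : Fin m => ν) := integral_integral_swap hJp
  have hxw : Integrable (fun w => ‖x w‖ ^ 2) (messageLaw M) := Integrable.of_finite
  have hx : Integrable (fun q : Fin M × (ι → ℂ) => ‖x q.1‖ ^ 2) (mixLaw M ι) := hxw.comp_fst _
  have hxint : ∫ q : Fin M × (ι → ℂ), ‖x q.1‖ ^ 2 ∂(mixLaw M ι) =
      ∫ w, ‖x w‖ ^ 2 ∂(messageLaw M) := by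
    rw [mixLaw, integral_fun_fst (f := fun w => ‖x w‖ ^ 2)]; simp
  have hz := integrable_norm_sq_noise (M := M) b
  have hL := integrable_log_mixDensity μ D
  have hr1 : ∀ y, ∫⁻ u, ENNReal.ofReal (δ / (2 * Real.pi) *
      (posteriorMean μ D b cauchyKernel y u * (1 + ‖u‖ ^ 2) ^ (-δ))) ≤ 1 := by
    intro y
    simp only [ENNReal.ofReal_mul hc0.le]
    rw [lintegral_const_mul']
    · calc _ ≤ ENNReal.ofReal (δ / (2 * Real.pi)) * ENNReal.ofReal (2 * Real.pi / δ) := by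
            gcongr
            exact lintegral_posteriorMean_le μ D b measurable_cauchyKernel
              (fun u => (cauchyKernel_pos u).le) (by fun_prop) (fun u => by positivity) _
              (fun c => lintegral_cauchyKernel_mul_le hδ c) y
        _ = 1 := by
            rw [← ENNReal.ofReal_mul hc0.le, div_mul_div_cancel₀' (by positivity)]
            simp
    · exact ENNReal.ofReal_ne_top
  -- In `B` below, the constants come from the normalisation of the test density, the Jensen bound,
  -- the comparison of kernels and the weight. `J` integrates to the entropy with the generic
  -- coordinate `a`, and the last logarithm cancels `mixEntropy μ D`.
  have key := MIMOME.mixEntropy_insert_le μ hb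
    (fun y u => δ / (2 * Real.pi) * (posteriorMean μ D b cauchyKernel y u * (1 + ‖u‖ ^ 2) ^ (-δ)))
    (by
      have := measurable_posteriorMean μ D b measurable_cauchyKernel
      refine measurable_const.mul (this.mul (Measurable.pow_const ?_ _))
      fun_prop)
    (fun y u => mul_pos hc0 (mul_pos (posteriorMean_pos μ D b cauchyKernel_pos y u) (by positivity)))
    (fun y y' u hy => by simp only [posteriorMean_congr μ D b cauchyKernel u hy])
    hr1 (B := fun q => (Real.log (2 * Real.pi / δ) + Real.log (1 / Real.pi + K * fmax) + Real.log 2 +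
      δ * (Real.log (1 + p) + 1 / (1 + p))) +
      (1 + δ * (2 / (1 + p))) * ‖q.2 b‖ ^ 2 + δ * (2 * K / (1 + p)) * ‖x q.1‖ ^ 2 +
      J q + Real.log (mixDensity μ D (μ q.1 + q.2)))
    (((((integrable_const _).add (hz.const_mul _)).add (hx.const_mul _)).add hJ).add hL) ?_
  · rw [integral_add (by exact ((((integrable_const _).add (hz.const_mul _)).add
        (hx.const_mul _)).add hJ)) hL, integral_add (by exact (((integrable_const _).add
        (hz.const_mul _)).add (hx.const_mul _))) hJ, integral_add (by exact ((integrable_const _).add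
        (hz.const_mul _))) (hx.const_mul _), integral_add (integrable_const _) (hz.const_mul _),
      integral_const_mul, integral_const_mul, hJint, hxint, integral_norm_sq_noise] at key
    simp only [integral_const, probReal_univ, one_smul] at key
    have e : mixEntropy μ D = -∫ q, Real.log (mixDensity μ D (μ q.1 + q.2)) ∂(mixLaw M ι) := by
      rw [mixEntropy, integral_neg]
    rw [e] at key
    refine key.trans (le_of_eq ?_)
    rw [alignConst]
    ring
  · rintro ⟨w, z⟩
    simp only
    set y := μ w + z with hy
    have hyb : μ w b + z b = y b := rfl
    rw [hyb]
    have hN : 0 < ∑ w', lik D (μ w') y * cauchyKernel (y b - μ w' b) :=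
      Finset.sum_pos (fun w' _ => mul_pos (lik_pos _ _ _) (cauchyKernel_pos _))
        ⟨0, Finset.mem_univ _⟩
    have hA : 0 < ∑ w', lik D (μ w') y * (1 + K * ‖x w - x w'‖ ^ 2)⁻¹ :=
      Finset.sum_pos (fun w' _ => mul_pos (lik_pos _ _ _) (by positivity)) ⟨0, Finset.mem_univ _⟩
    have hzb : 0 < 1 + ‖z b‖ ^ 2 := by positivity
    have hyb0 : 0 < 1 + ‖y b‖ ^ 2 := by positivity
    have hAN : ∑ w', lik D (μ w') y * (1 + K * ‖x w - x w'‖ ^ 2)⁻¹ ≤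
        2 * (1 + ‖z b‖ ^ 2) * ∑ w', lik D (μ w') y * cauchyKernel (y b - μ w' b) := by
      rw [Finset.mul_sum]
      refine Finset.sum_le_sum fun w' _ => ?_
      rw [mul_left_comm]
      refine mul_le_mul_of_nonneg_left ?_ (lik_pos _ _ _).le
      refine cauchyKernel_add_ge hK (norm_linearForm_sq_le (x := x w - x w') hg) ?_
      rw [hy, Pi.add_apply, hμ, hμ]
      simp only [Pi.sub_apply, mul_sub, Finset.sum_sub_distrib]
      ring
    have l1 := Real.log_le_log hA hAN
    rw [Real.log_mul (by positivity) hN.ne', Real.log_mul two_ne_zero hzb.ne'] at l1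
    have l2 : Real.log (1 + ‖z b‖ ^ 2) ≤ ‖z b‖ ^ 2 := by
      linarith [Real.log_le_sub_one_of_pos hzb]
    have l3 := h.neg_log_le hK μ ha x w z
    -- The tangent to the logarithm at `1 + p` makes the bound linear in `‖x w‖²`, hence
    -- controllable by the mean power.
    have l4 : Real.log (1 + ‖y b‖ ^ 2) ≤
        Real.log (1 + p) + (1 + 2 * ‖z b‖ ^ 2 + 2 * K * ‖x w‖ ^ 2) / (1 + p) := by
      have hp1 : 0 < 1 + p := by linarith
      have h1 := Real.log_le_sub_one_of_pos (div_pos hyb0 hp1)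
      rw [Real.log_div hyb0.ne' hp1.ne'] at h1
      have h2 : ‖y b‖ ^ 2 ≤ 2 * ‖z b‖ ^ 2 + 2 * K * ‖x w‖ ^ 2 := by
        have h3 : ‖y b‖ ≤ ‖μ w b‖ + ‖z b‖ := norm_add_le _ _
        have h4 : ‖μ w b‖ ^ 2 ≤ K * ‖x w‖ ^ 2 := hμ w ▸ norm_linearForm_sq_le hg
        nlinarith [norm_nonneg (y b), norm_nonneg (z b), norm_nonneg (μ w b),
          sq_nonneg (‖z b‖ - ‖μ w b‖)]
      have h5 : (1 + ‖y b‖ ^ 2) / (1 + p) ≤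
        (1 + 2 * ‖z b‖ ^ 2 + 2 * K * ‖x w‖ ^ 2) / (1 + p) :=
        div_le_div_of_nonneg_right (by linarith) hp1.le
      linarith
    have l5 : Real.log (δ / (2 * Real.pi) * (posteriorMean μ D b cauchyKernel y (y b) *
        (1 + ‖y b‖ ^ 2) ^ (-δ))) = -Real.log (2 * Real.pi / δ) +
        Real.log (∑ w', lik D (μ w') y * cauchyKernel (y b - μ w' b)) -
        Real.log (mixDensity μ D y) - δ * Real.log (1 + ‖y b‖ ^ 2) := by
      rw [Real.log_mul hc0.ne' (mul_pos (posteriorMean_pos μ D b cauchyKernel_pos y _)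
        (by positivity)).ne', Real.log_mul (posteriorMean_pos μ D b cauchyKernel_pos y _).ne'
        (by positivity), Real.log_rpow hyb0, posteriorMean,
        Real.log_div hN.ne' (mixDensity_pos _ _ _).ne', ← inv_div, Real.log_inv]
      ring
    have l6 := mul_le_mul_of_nonneg_left l4 hδ.le
    have l7 : δ * (Real.log (1 + p) + (1 + 2 * ‖z b‖ ^ 2 + 2 * K * ‖x w‖ ^ 2) / (1 + p)) =
        δ * (Real.log (1 + p) + 1 / (1 + p)) + δ * (2 / (1 + p)) * ‖z b‖ ^ 2 +
        δ * (2 * K / (1 + p)) * ‖x w‖ ^ 2 := by ring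
    rw [l5]
    change _ ≤ _ + ∫ g', -Real.log (mixDensity (setMean μ a x g') (insert a D)
      (setMean μ a x g' w + z)) ∂(Measure.pi fun _ : Fin m => ν) + _
    linarith

end Alignment

/-! ### Set functions with diminishing increments -/

section Submodular

variable {α κ τ : Type*} [DecidableEq α]

/-- A set function whose increments decrease. -/
def DiminishingIncrements (h : Finset α → ℝ) : Prop :=
  ∀ ⦃S T : Finset α⦄ ⦃a : α⦄, S ⊆ T → a ∉ T → h (insert a T) + h S ≤ h (insert a S) + h T

lemma DiminishingIncrements.union {h : Finset α → ℝ} (hh : DiminishingIncrements h)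
    {A S T : Finset α} (hST : S ⊆ T) (hA : Disjoint A T) : h (A ∪ T) + h S ≤ h (A ∪ S) + h T := by
  induction A using Finset.induction_on with
  | empty => simp [add_comm]
  | insert a A ha ih =>
    rw [Finset.disjoint_insert_left] at hA
    rw [Finset.insert_union, Finset.insert_union]
    have h1 := hh (Finset.union_subset_union_right (s := A) hST)
      (a := a) (by simp [ha, hA.1])
    have h2 := ih hA.2
    linarith

/-- Subadditivity of conditional entropy, by the chain rule: dropping the earlier blocks from the
conditioning only increases each term. -/
lemma DiminishingIncrements.biUnion_le {h : Finset α → ℝ} (hh : DiminishingIncrements h)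
    [DecidableEq κ] {B : κ → Finset α} {T : Finset α} (hB : Pairwise fun r s => Disjoint (B r) (B s))
    (hT : ∀ r, Disjoint (B r) T) (s : Finset κ) :
    h (s.biUnion B ∪ T) - h T ≤ ∑ r ∈ s, (h (B r ∪ T) - h T) := by
  induction s using Finset.induction_on with
  | empty => simp
  | insert r s hr ih =>
    rw [Finset.sum_insert hr, Finset.biUnion_insert, Finset.union_assoc]
    have := hh.union (A := B r) (S := T) (T := s.biUnion B ∪ T) Finset.subset_union_right (by
      rw [Finset.disjoint_union_right, Finset.disjoint_biUnion_right]
      exact ⟨fun k hk => hB fun e => hr (e ▸ hk), hT r⟩)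
    linarith

/-- A Han type inequality: in the chain rule each block is conditioned on the earlier ones, and
conditioning on all other blocks only decreases its term. -/
lemma DiminishingIncrements.le_biUnion {h : Finset α → ℝ} (hh : DiminishingIncrements h)
    [DecidableEq κ] [Fintype κ] {C : κ → Finset α} {Q : Finset α}
    (hC : Pairwise fun r s => Disjoint (C r) (C s)) (hQ : ∀ r, Disjoint (C r) Q) (s : Finset κ) :
    ∑ k ∈ s, (h (Finset.univ.biUnion C ∪ Q) - h ((Finset.univ.erase k).biUnion C ∪ Q)) ≤
      h (s.biUnion C ∪ Q) - h Q := by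
  induction s using Finset.induction_on with
  | empty => simp
  | insert k s hk ih =>
    rw [Finset.sum_insert hk, Finset.biUnion_insert, Finset.union_assoc]
    have := hh.union (A := C k) (S := s.biUnion C ∪ Q) (T := (Finset.univ.erase k).biUnion C ∪ Q)
      (Finset.union_subset_union_left (Finset.biUnion_subset_biUnion_of_subset_left _ fun l hl =>
        Finset.mem_erase.2 ⟨fun e => hk (e ▸ hl), Finset.mem_univ _⟩)) (by
      rw [Finset.disjoint_union_right, Finset.disjoint_biUnion_right]
      exact ⟨fun l hl => hC (Finset.ne_of_mem_erase hl).symm, hQ k⟩)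
    rw [← Finset.union_assoc, ← Finset.biUnion_insert, Finset.insert_erase (Finset.mem_univ k)] at this
    linarith

/-- Exchanging blocks one element at a time. -/
lemma image_exchange_le [DecidableEq τ] [Fintype τ] {h : Finset α → ℝ} {a b : τ → α} {e : τ → ℝ}
    (ha : Function.Injective a) (hb : Function.Injective b) (hab : ∀ s t, a s ≠ b t)
    (hstep : ∀ t D, a t ∉ D → b t ∉ D → h (insert (b t) D) ≤ h (insert (a t) D) + e t)
    {D : Finset α} (haD : Disjoint (Finset.univ.image a) D) (hbD : Disjoint (Finset.univ.image b) D) :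
    h (Finset.univ.image b ∪ D) ≤ h (Finset.univ.image a ∪ D) + ∑ t, e t := by
  have haD' : ∀ t, a t ∉ D := fun t => Finset.disjoint_left.1 haD (by simp)
  have hbD' : ∀ t, b t ∉ D := fun t => Finset.disjoint_left.1 hbD (by simp)
  -- Hybrid argument: the elements indexed by `U` have already been exchanged, the others not yet.
  have main : ∀ U : Finset τ, h (Finset.univ.image b ∪ D) ≤
      h (U.image a ∪ (Uᶜ.image b ∪ D)) + ∑ t ∈ U, e t := by
    intro U
    induction U using Finset.induction_on with
    | empty => simp
    | insert t U ht ih =>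
      have h1 : Uᶜ = insert t (insert t U)ᶜ := by
        ext s; by_cases hs : s = t <;> simp [hs, ht]
      rw [h1, Finset.image_insert, Finset.insert_union, Finset.union_insert] at ih
      have h2 := hstep t (U.image a ∪ ((insert t U)ᶜ.image b ∪ D))
        (by simp [ha.eq_iff, ht, haD' t, fun s => (hab t s).symm])
        (by simp [hb.eq_iff, hab, hbD' t])
      rw [Finset.image_insert, Finset.insert_union, Finset.sum_insert ht]
      linarith
  simpa using main Finset.univ

/-- The exchange argument: if blocks `B r` may be exchanged for blocks `C k` at the cost `E`, the
increments per block compare. -/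
lemma DiminishingIncrements.blocks_le {h : Finset α → ℝ} (hh : DiminishingIncrements h)
    [DecidableEq κ] [Fintype κ] [DecidableEq τ] [Fintype τ] {B : τ → Finset α} {C : κ → Finset α}
    {Q : Finset α} (hB : Pairwise fun r s => Disjoint (B r) (B s))
    (hC : Pairwise fun r s => Disjoint (C r) (C s)) (hBC : ∀ r k, Disjoint (B r) (C k))
    (hBQ : ∀ r, Disjoint (B r) Q) (hCQ : ∀ k, Disjoint (C k) Q) {E : ℝ}
    (hE : ∀ r k D, Disjoint (B r) D → Disjoint (C k) D → h (B r ∪ D) ≤ h (C k ∪ D) + E) :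
    Fintype.card κ * (h (Finset.univ.biUnion B ∪ (Finset.univ.biUnion C ∪ Q)) -
        h (Finset.univ.biUnion C ∪ Q)) ≤
      Fintype.card τ * (h (Finset.univ.biUnion C ∪ Q) - h Q) +
        Fintype.card τ * (Fintype.card κ * E) := by
  set V := Finset.univ.biUnion C ∪ Q with hV
  have hBV : ∀ r, Disjoint (B r) V := fun r => by
    rw [hV, Finset.disjoint_union_right, Finset.disjoint_biUnion_right]
    exact ⟨fun k _ => hBC r k, hBQ r⟩
  have h1 := hh.biUnion_le hB hBV Finset.univ
  have h2 := hh.le_biUnion hC hCQ Finset.univ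
  -- `C k` is dropped from the conditioning of `B r`, which makes room to exchange `B r` for `C k`.
  have h3 : ∀ r k, h (B r ∪ V) - h V ≤ h V - h ((Finset.univ.erase k).biUnion C ∪ Q) + E := by
    intro r k
    set R := (Finset.univ.erase k).biUnion C ∪ Q with hR
    have hRV : R ⊆ V := Finset.union_subset_union_left
      (Finset.biUnion_subset_biUnion_of_subset_left _ (Finset.erase_subset _ _))
    have hCR : Disjoint (C k) R := by
      rw [hR, Finset.disjoint_union_right, Finset.disjoint_biUnion_right]
      exact ⟨fun l hl => hC (Finset.ne_of_mem_erase hl).symm, hCQ k⟩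
    have h4 := hh.union hRV (hBV r)
    have h5 := hE r k R ((hBV r).mono_right hRV) hCR
    have h6 : C k ∪ R = V := by
      rw [hR, hV, ← Finset.union_assoc, ← Finset.biUnion_insert,
        Finset.insert_erase (Finset.mem_univ k)]
    rw [h6] at h5
    linarith
  have h4 : ∀ r, Fintype.card κ * (h (B r ∪ V) - h V) ≤ (h V - h Q) + Fintype.card κ * E := by
    intro r
    have := Finset.sum_le_sum fun k (_ : k ∈ Finset.univ) => h3 r k
    rw [Finset.sum_const, Finset.sum_add_distrib, Finset.sum_const, Finset.card_univ,
      nsmul_eq_mul, nsmul_eq_mul] at this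
    linarith
  have h5 := Finset.sum_le_sum fun r (_ : r ∈ Finset.univ) => h4 r
  rw [← Finset.mul_sum, Finset.sum_const, Finset.card_univ, nsmul_eq_mul] at h5
  have h6 := mul_le_mul_of_nonneg_left h1 (Nat.cast_nonneg (α := ℝ) (Fintype.card κ))
  linarith

end Submodular

/-! ### The averaged entropies of the channel outputs -/

/-- The receive antennas at all times. -/
abbrev Antenna (n : ℕ) (N : Fin 3 → ℕ) : Type := Σ _ : Fin n, Σ j : Fin 3, Fin (N j)

/-- The law of the rows of the channel matrices. -/
noncomputable def rowLaw (n m : ℕ) (N : Fin 3 → ℕ) (ν : Measure ℂ) :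
    Measure (Antenna n N → Fin m → ℂ) :=
  Measure.pi fun _ => Measure.pi fun _ => ν

instance {n m : ℕ} {N : Fin 3 → ℕ} {ν : Measure ℂ} [IsProbabilityMeasure ν] :
    IsProbabilityMeasure (rowLaw n m N ν) := by unfold rowLaw; infer_instance

section Averaged

variable {M n m : ℕ} {N : Fin 3 → ℕ}

/-- The vector sent at time `t` for the message `w`, when `G` are the channel coefficients. -/
def Encoder.inputAt (f : Encoder M n m (N 0)) (t : Fin n) (w : Fin M)
    (G : Antenna n N → Fin m → ℂ) : Fin m → ℂ :=
  f.toFun t w fun s r => G ⟨Fin.castLE t.isLt.le s, 0, r⟩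

/-- The noiseless outputs. -/
def Encoder.mean (f : Encoder M n m (N 0)) (G : Antenna n N → Fin m → ℂ) (w : Fin M)
    (i : Antenna n N) : ℂ := ∑ k, G i k * f.inputAt i.1 w G k

lemma Encoder.measurable_inputAt (f : Encoder M n m (N 0)) (t : Fin n) (w : Fin M) :
    Measurable fun G : Antenna n N → Fin m → ℂ => f.inputAt t w G :=
  (f.measurable_toFun t w).comp (by fun_prop)

lemma Encoder.measurable_mean (f : Encoder M n m (N 0)) :
    Measurable (f.mean : (Antenna n N → Fin m → ℂ) → Fin M → Antenna n N → ℂ) := by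
  refine measurable_pi_iff.2 fun w => measurable_pi_iff.2 fun i => ?_
  refine Finset.measurable_sum _ fun k _ => ?_
  exact Measurable.mul (by fun_prop) ((measurable_pi_apply k).comp (f.measurable_inputAt i.1 w))

/-- Feedback comes from receiver `0` alone, so changing a row of another receiver alters no input at
any time; only the noiseless output at that row changes. -/
lemma Encoder.mean_update (f : Encoder M n m (N 0)) (G : Antenna n N → Fin m → ℂ)
    (a : Antenna n N) (ha : a.2.1 ≠ 0) (g : Fin m → ℂ) :
    f.mean (Function.update G a g) = setMean (f.mean G) a (fun w => f.inputAt a.1 w G) g := by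
  have hx : ∀ t w, f.inputAt t w (Function.update G a g) = f.inputAt t w G := by
    intro t w
    unfold Encoder.inputAt
    congr 1
    funext s r
    rw [Function.update_of_ne]
    rintro rfl
    exact ha rfl
  funext w i
  simp only [Encoder.mean, setMean, hx]
  by_cases hi : i = a
  · subst hi; simp
  · simp [hi, Encoder.mean]

variable [NeZero M]

/-- The entropy of the antennas in `S` given the channel coefficients, up to a constant. -/
noncomputable def avgEntropy (f : Encoder M n m (N 0)) (ν : Measure ℂ)
    (S : Finset (Antenna n N)) : ℝ := ∫ G, mixEntropy (f.mean G) S ∂(rowLaw n m N ν)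

variable {ν : Measure ℂ} [IsProbabilityMeasure ν] (f : Encoder M n m (N 0))

lemma integrable_mixEntropy_mean (S : Finset (Antenna n N)) :
    Integrable (fun G => mixEntropy (f.mean G) S) (rowLaw n m N ν) :=
  Integrable.of_bound (measurable_mixEntropy f.measurable_mean S).aestronglyMeasurable _
    (ae_of_all _ fun _ => abs_mixEntropy_le _ S)

lemma diminishingIncrements_avgEntropy :
    DiminishingIncrements (avgEntropy f ν : Finset (Antenna n N) → ℝ) := by
  intro S T a hST ha
  have i := fun S => integrable_mixEntropy_mean (ν := ν) f S
  unfold avgEntropy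
  rw [← integral_add (i _) (i _), ← integral_add (i _) (i _)]
  exact integral_mono ((i _).add (i _)) ((i _).add (i _)) fun G =>
    mixEntropy_insert_add_le (f.mean G) hST ha

/-- The mean power at time `t`, when the channel coefficients are given. -/
noncomputable def Encoder.powerAt (t : Fin n) (G : Antenna n N → Fin m → ℂ) :
    ℝ := ∫ w, ‖f.inputAt t w G‖ ^ 2 ∂(messageLaw M)

/-- With all other rows fixed, the row of `a` is still distributed as `m` independent coefficients,
and `IsChannelLaw.mixEntropy_insert_le` applies. The set `D` may contain later outputs, whose inputs
depend on the row of `b`: that row is fixed here and only its boundedness is needed. -/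
lemma avgEntropy_exchange_le {dmax fmax : ℝ} (hν : IsChannelLaw dmax fmax ν) {δ p : ℝ}
    (hδ : 0 < δ) (hp : 0 < p) (t : Fin n)
    (hP : Integrable (fun G => f.powerAt t G) (rowLaw n m N ν)) (r : Fin (N 0)) (k : Fin (N 1))
    {D : Finset (Antenna n N)} (ha : (⟨t, 1, k⟩ : Antenna n N) ∉ D)
    (hb : (⟨t, 0, r⟩ : Antenna n N) ∉ D) :
    avgEntropy f ν (insert ⟨t, 0, r⟩ D) ≤ avgEntropy f ν (insert ⟨t, 1, k⟩ D) +
      (alignConst ((m * dmax) ^ 2) fmax δ p + δ * (2 * (m * dmax) ^ 2 / (1 + p)) *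
        ∫ G, f.powerAt t G ∂(rowLaw n m N ν)) := by
  set a : Antenna n N := ⟨t, 1, k⟩ with hadef
  set b : Antenna n N := ⟨t, 0, r⟩ with hbdef
  have hu : MeasurePreserving
      (fun q : (Antenna n N → Fin m → ℂ) × (Fin m → ℂ) => Function.update q.1 a q.2)
      ((rowLaw n m N ν).prod (Measure.pi fun _ => ν)) (rowLaw n m N ν) :=
    measurePreserving_update (Measure.pi fun _ : Fin m => ν) a
  have hF := (measurable_mixEntropy f.measurable_mean (insert a D)).aestronglyMeasurable
    (μ := rowLaw n m N ν)
  have hi := integrable_mixEntropy_mean (ν := ν) f (insert a D)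
  have hi2 : Integrable (fun q : (Antenna n N → Fin m → ℂ) × (Fin m → ℂ) =>
      mixEntropy (f.mean (Function.update q.1 a q.2)) (insert a D))
      ((rowLaw n m N ν).prod (Measure.pi fun _ => ν)) :=
    (hu.integrable_comp hF).2 hi
  -- The row of `a` is resampled, which turns the entropy at `a` into one averaged over a generic
  -- linear form.
  have e1 : avgEntropy f ν (insert a D) = ∫ G, ∫ g, mixEntropy
      (setMean (f.mean G) a (fun w => f.inputAt t w G) g) (insert a D)
      ∂(Measure.pi fun _ : Fin m => ν) ∂(rowLaw n m N ν) := by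
    have e0 := integral_map hu.measurable.aemeasurable (hu.map_eq.symm ▸ hF)
    rw [hu.map_eq, integral_prod _ hi2] at e0
    rw [avgEntropy, e0]
    refine integral_congr_ae (ae_of_all _ fun G => integral_congr_ae (ae_of_all _ fun g => ?_))
    simp only
    rw [f.mean_update G a (by simp [a]) g]
  have hi3 : Integrable (fun G => ∫ g, mixEntropy
      (setMean (f.mean G) a (fun w => f.inputAt t w G) g) (insert a D)
      ∂(Measure.pi fun _ : Fin m => ν)) (rowLaw n m N ν) := by
    refine hi2.integral_prod_left.congr (ae_of_all _ fun G =>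
      integral_congr_ae (ae_of_all _ fun g => ?_))
    simp only
    rw [f.mean_update G a (by simp [a]) g]
  have hbound : ∀ᵐ G ∂(rowLaw n m N ν), ∀ i, ‖G b i‖ ≤ dmax := by
    have h1 : ∀ᵐ g ∂(Measure.pi fun _ : Fin m => ν), ∀ i, ‖g i‖ ≤ dmax :=
      ae_all_iff.2 fun i => (Measure.tendsto_eval_ae_ae (μ := fun _ : Fin m => ν) (i := i)).eventually
        hν.norm_le
    exact (Measure.tendsto_eval_ae_ae (μ := fun _ : Antenna n N => Measure.pi fun _ : Fin m => ν)
      (i := b)).eventually h1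
  have hPc := hP.const_mul (δ * (2 * (m * dmax) ^ 2 / (1 + p)))
  have key := integral_mono_ae (integrable_mixEntropy_mean (ν := ν) f (insert b D))
    (hi3.add ((integrable_const (alignConst ((m * dmax) ^ 2) fmax δ p)).add hPc)) (by
      filter_upwards [hbound] with G hG
      exact hν.mixEntropy_insert_le hδ hp (f.mean G) ha hb (fun w => f.inputAt t w G) (G b) hG
        fun w => rfl)
  simp only [Pi.add_apply] at key
  rw [integral_add hi3 (by exact (integrable_const _).add hPc), integral_add (integrable_const _) hPc,
    integral_const_mul, ← e1] at key
  simp only [integral_const, probReal_univ, one_smul] at key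
  exact key

/-- The antennas of receiver `j` at position `r`, at all times. -/
def antennaRow (n : ℕ) {N : Fin 3 → ℕ} (j : Fin 3) (r : Fin (N j)) : Finset (Antenna n N) :=
  Finset.univ.image fun t => ⟨t, j, r⟩

/-- The antennas of receiver `j`. -/
def receiver (n : ℕ) (N : Fin 3 → ℕ) (j : Fin 3) : Finset (Antenna n N) :=
  Finset.univ.biUnion fun r : Fin (N j) => antennaRow n j r

omit [NeZero M] in
lemma mem_antennaRow {j : Fin 3} {r : Fin (N j)} {i : Antenna n N} :
    i ∈ antennaRow n j r ↔ i.2 = ⟨j, r⟩ := by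
  rcases i with ⟨t, j', r'⟩
  simp [antennaRow, eq_comm]

lemma mem_receiver {j : Fin 3} {i : Antenna n N} : i ∈ receiver n N j ↔ i.2.1 = j := by
  rcases i with ⟨t, j', r'⟩
  simp only [receiver, Finset.mem_biUnion, Finset.mem_univ, true_and, mem_antennaRow]
  constructor
  · rintro ⟨r, h⟩
    exact congrArg Sigma.fst h
  · rintro rfl
    exact ⟨r', rfl⟩

lemma disjoint_antennaRow {j j' : Fin 3} {r : Fin (N j)} {r' : Fin (N j')}
    (h : (⟨j, r⟩ : Σ j : Fin 3, Fin (N j)) ≠ ⟨j', r'⟩) :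
    Disjoint (antennaRow n j r) (antennaRow n j' r') := by
  rw [Finset.disjoint_left]
  intro i hi hi'
  exact h ((mem_antennaRow.1 hi).symm.trans (mem_antennaRow.1 hi'))

/-- The comparison of the averaged entropies. -/
lemma avgEntropy_blocks_le {dmax fmax : ℝ} (hν : IsChannelLaw dmax fmax ν) {δ p : ℝ}
    (hδ : 0 < δ) (hp : 0 < p)
    (hP : ∀ t, Integrable (fun G => f.powerAt t G) (rowLaw n m N ν))
    (hsum : ∑ t, ∫ G, f.powerAt t G ∂(rowLaw n m N ν) ≤ n * p) :
    N 1 * (avgEntropy f ν (receiver n N 0 ∪ (receiver n N 1 ∪ receiver n N 2)) -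
        avgEntropy f ν (receiver n N 1 ∪ receiver n N 2)) ≤
      N 0 * (avgEntropy f ν (receiver n N 1 ∪ receiver n N 2) - avgEntropy f ν (receiver n N 2)) +
      N 0 * (N 1 * (n * (alignConst ((m * dmax) ^ 2) fmax δ p + δ * (2 * (m * dmax) ^ 2)))) := by
  have hrow : ∀ (j j' : Fin 3) (r : Fin (N j)), j ≠ j' →
      Disjoint (antennaRow n j r) (receiver n N j') := fun j j' r h => by
    rw [Finset.disjoint_left]
    intro i hi hi'
    rw [mem_antennaRow] at hi
    rw [mem_receiver, hi] at hi'
    exact h hi'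
  have hpair : ∀ j : Fin 3, Pairwise fun r s : Fin (N j) =>
      Disjoint (antennaRow n j r) (antennaRow n j s) := fun j r s hrs =>
    disjoint_antennaRow fun h => hrs (by simpa using h)
  have := (diminishingIncrements_avgEntropy (ν := ν) f).blocks_le (B := fun r => antennaRow n 0 r)
    (C := fun k => antennaRow n 1 k) (Q := receiver n N 2) (hpair 0) (hpair 1)
    (fun r k => disjoint_antennaRow fun h => by simpa using congrArg Sigma.fst h)
    (fun r => hrow 0 2 r (by decide)) (fun k => hrow 1 2 k (by decide))
    (E := n * (alignConst ((m * dmax) ^ 2) fmax δ p + δ * (2 * (m * dmax) ^ 2))) ?_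
  · simp only [Fintype.card_fin] at this
    exact this
  · intro r k D hr hk
    refine (image_exchange_le (a := fun t => (⟨t, 1, k⟩ : Antenna n N)) (b := fun t => ⟨t, 0, r⟩)
      (fun s t h => congrArg Sigma.fst h) (fun s t h => congrArg Sigma.fst h)
      (fun s t h => by simpa using congrArg (fun i : Antenna n N => i.2.1) h)
      (fun t D ha hb => avgEntropy_exchange_le f hν hδ hp t (hP t) r k ha hb) hk hr).trans ?_
    refine add_le_add le_rfl ?_
    rw [Finset.sum_add_distrib, Finset.sum_const, Finset.card_univ, Fintype.card_fin, nsmul_eq_mul,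
      ← Finset.mul_sum, mul_add]
    refine add_le_add le_rfl ?_
    have hp1 : 0 < 1 + p := by linarith
    have hc : 0 ≤ δ * (2 * (m * dmax) ^ 2 / (1 + p)) := by positivity
    refine (mul_le_mul_of_nonneg_left hsum hc).trans ?_
    have h1 : p / (1 + p) ≤ 1 := (div_le_one hp1).2 (by linarith)
    have h2 : 0 ≤ n * (δ * (2 * (m * dmax) ^ 2)) := by positivity
    calc δ * (2 * (m * dmax) ^ 2 / (1 + p)) * (n * p)
        = n * (δ * (2 * (m * dmax) ^ 2)) * (p / (1 + p)) := by ring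
      _ ≤ _ := mul_le_of_le_one_right h2 h1

end Averaged

/-! ### The entropies of the channel outputs -/

section Link

variable {M n m : ℕ} {N : Fin 3 → ℕ}

/-- Families indexed by time, receiver and antenna as families indexed by antennas. -/
def flatten {E : Type*} (z : Fin n → (j : Fin 3) → Fin (N j) → E) (i : Antenna n N) : E :=
  z i.1 i.2.1 i.2.2

/-- The density of the noise of one receiver. -/
noncomputable def blockDensity {k : ℕ} (y : Fin n → Fin k → ℂ) : ℝ≥0∞ :=
  ∏ t, ∏ r, ENNReal.ofReal (gaussDensity (y t r))

@[fun_prop]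
lemma measurable_blockDensity {k : ℕ} : Measurable (blockDensity : (Fin n → Fin k → ℂ) → ℝ≥0∞) := by
  unfold blockDensity; fun_prop

lemma blockDensity_ne_zero {k : ℕ} (y : Fin n → Fin k → ℂ) : blockDensity y ≠ 0 :=
  Finset.prod_ne_zero_iff.2 fun _ _ => Finset.prod_ne_zero_iff.2 fun _ _ =>
    (ENNReal.ofReal_pos.2 (gaussDensity_pos _)).ne'

lemma blockDensity_ne_top {k : ℕ} (y : Fin n → Fin k → ℂ) : blockDensity y ≠ ∞ :=
  ENNReal.prod_ne_top fun _ _ => ENNReal.prod_ne_top fun _ _ => ENNReal.ofReal_ne_top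

lemma pi_pi_complexGaussian (n k : ℕ) :
    (Measure.pi fun _ : Fin n => Measure.pi fun _ : Fin k => complexGaussian) =
      volume.withDensity blockDensity := by
  have h1 : (Measure.pi fun _ : Fin k => complexGaussian) = (volume : Measure (Fin k → ℂ)).withDensity
      fun y => ∏ r, ENNReal.ofReal (gaussDensity (y r)) := by
    have : SigmaFinite ((volume : Measure ℂ).withDensity fun z => ENNReal.ofReal (gaussDensity z)) :=
      complexGaussian_eq ▸ inferInstance
    exact pi_withDensity volume _ (by fun_prop)
  have : SigmaFinite ((volume : Measure (Fin k → ℂ)).withDensity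
      fun y => ∏ r, ENNReal.ofReal (gaussDensity (y r))) := h1 ▸ inferInstance
  rw [h1]
  exact pi_withDensity volume _ (by fun_prop)

instance (n k : ℕ) : IsProbabilityMeasure
    ((volume : Measure (Fin n → Fin k → ℂ)).withDensity blockDensity) :=
  pi_pi_complexGaussian n k ▸ inferInstance

lemma lintegral_blockDensity (n k : ℕ) : ∫⁻ y : Fin n → Fin k → ℂ, blockDensity y = 1 := by
  have := measure_univ (μ := (volume : Measure (Fin n → Fin k → ℂ)).withDensity blockDensity)
  rwa [withDensity_apply _ MeasurableSet.univ, Measure.restrict_univ] at this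

lemma blockDensity_sub (j : Fin 3) (c y : Antenna n N → ℂ) :
    blockDensity ((fun t r => y ⟨t, j, r⟩) - fun t r => c ⟨t, j, r⟩) =
      ENNReal.ofReal (lik (receiver n N j) c y) := by
  have hd : ((Finset.univ : Finset (Fin (N j))) : Set (Fin (N j))).PairwiseDisjoint
      fun r => antennaRow n j r :=
    fun r _ s _ hrs => disjoint_antennaRow fun h => hrs (by simpa using h)
  rw [lik, receiver, Finset.prod_biUnion hd, blockDensity, Finset.prod_comm,
    ENNReal.ofReal_prod_of_nonneg fun r _ => Finset.prod_nonneg fun _ _ => (gaussDensity_pos _).le]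
  refine Finset.prod_congr rfl fun r _ => ?_
  rw [antennaRow, Finset.prod_image fun s _ t _ h => congrArg Sigma.fst h,
    ENNReal.ofReal_prod_of_nonneg fun t _ => (gaussDensity_pos _).le]
  rfl

lemma lik_union {ι : Type*} [DecidableEq ι] {S T : Finset ι} (h : Disjoint S T) (c y : ι → ℂ) :
    lik (S ∪ T) c y = lik S c y * lik T c y := Finset.prod_union h

lemma disjoint_receiver {j j' : Fin 3} (h : j ≠ j') : Disjoint (receiver n N j) (receiver n N j') :=
  Finset.disjoint_left.2 fun _ hi hi' => h ((mem_receiver.1 hi).symm.trans (mem_receiver.1 hi'))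

lemma ofReal_mixDensity {ι : Type*} (μ : Fin M → ι → ℂ) (S : Finset ι) (y : ι → ℂ) :
    ENNReal.ofReal (mixDensity μ S y) = ∑ w, ENNReal.ofReal (lik S (μ w) y) :=
  ENNReal.ofReal_sum_of_nonneg fun _ _ => (lik_pos _ _ _).le

lemma shiftSum_blockDensity (μ : Fin M → Antenna n N → ℂ) (j : Fin 3) (y : Antenna n N → ℂ) :
    shiftSum blockDensity (fun w t r => μ w ⟨t, j, r⟩) (fun t r => y ⟨t, j, r⟩) =
      ENNReal.ofReal (mixDensity μ (receiver n N j) y) := by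
  rw [ofReal_mixDensity]
  exact Finset.sum_congr rfl fun w _ => blockDensity_sub j (μ w) y

lemma log_ofReal_div_ofReal {x y : ℝ} (hx : 0 < x) (hy : 0 < y) :
    Real.log (ENNReal.ofReal x / ENNReal.ofReal y).toReal = Real.log x - Real.log y := by
  rw [ENNReal.toReal_div, ENNReal.toReal_ofReal hx.le, ENNReal.toReal_ofReal hy.le,
    Real.log_div hx.ne' hy.ne']

lemma Encoder.measurable_mean_flatten (f : Encoder M n m (N 0)) (j : Fin 3) (w : Fin M) :
    Measurable fun (g : Channels n m N) (t : Fin n) (r : Fin (N j)) =>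
      f.mean (flatten g) w ⟨t, j, r⟩ := by
  have hflat : Measurable (flatten : Channels n m N → Antenna n N → Fin m → ℂ) := by
    unfold flatten; fun_prop
  exact measurable_pi_iff.2 fun t => measurable_pi_iff.2 fun r =>
    (measurable_pi_iff.1 (measurable_pi_iff.1 (f.measurable_mean.comp hflat) w) _)

variable [NeZero M]

lemma measurePreserving_law (ν : Measure ℂ) [IsProbabilityMeasure ν] :
    MeasurePreserving (fun ω : Outcome M n m N => (flatten ω.2.1, ω.1, flatten ω.2.2))
      (law M n m N ν) ((rowLaw n m N ν).prod (mixLaw M (Antenna n N))) := by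
  have h1 : MeasurePreserving (flatten : Channels n m N → Antenna n N → Fin m → ℂ)
      (Measure.pi fun _ => Measure.pi fun _ => Measure.pi fun _ => Measure.pi fun _ => ν)
      (rowLaw n m N ν) := measurePreserving_flatten (Measure.pi fun _ : Fin m => ν)
  have h2 : MeasurePreserving (flatten : Noise n N → Antenna n N → ℂ)
      (Measure.pi fun _ => Measure.pi fun _ => Measure.pi fun _ => complexGaussian)
      (Measure.pi fun _ => complexGaussian) := measurePreserving_flatten complexGaussian
  have h3 := (MeasurePreserving.id (messageLaw M)).prod (h1.prod h2)
  have h4 := (measurePreserving_prodAssoc (messageLaw M) (rowLaw n m N ν)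
    (Measure.pi fun _ : Antenna n N => complexGaussian)).symm
  have h5 := (Measure.measurePreserving_swap (μ := messageLaw M) (ν := rowLaw n m N ν)).prod
    (MeasurePreserving.id (Measure.pi fun _ : Antenna n N => complexGaussian))
  have h6 := measurePreserving_prodAssoc (rowLaw n m N ν) (messageLaw M)
    (Measure.pi fun _ : Antenna n N => complexGaussian)
  exact ((h6.comp h5).comp h4).comp h3

/-- The logarithm of the density of the outputs at the antennas in `S`. -/
noncomputable def logDensity (f : Encoder M n m (N 0)) (S : Finset (Antenna n N))
    (ω : Outcome M n m N) : ℝ :=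
  Real.log (mixDensity (f.mean (flatten ω.2.1)) S
    (f.mean (flatten ω.2.1) ω.1 + flatten ω.2.2))

/-- Fubini, with `logBound` as dominating function, identifies the mean over outcomes with the
channel average of mixture entropies. -/
lemma logDensity_spec (f : Encoder M n m (N 0)) (ν : Measure ℂ) [IsProbabilityMeasure ν]
    (S : Finset (Antenna n N)) :
    Integrable (logDensity f S) (law M n m N ν) ∧
      ∫ ω, logDensity f S ω ∂(law M n m N ν) = -avgEntropy f ν S := by
  let F : (Antenna n N → Fin m → ℂ) × (Fin M × (Antenna n N → ℂ)) → ℝ := fun p =>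
    Real.log (mixDensity (f.mean p.1) S (f.mean p.1 p.2.1 + p.2.2))
  have h1 : Measurable fun p : (Antenna n N → Fin m → ℂ) × (Fin M × (Antenna n N → ℂ)) =>
      f.mean p.1 p.2.1 := by
    have h : Measurable fun p : (Fin M → Antenna n N → ℂ) × Fin M => p.1 p.2 :=
      measurable_from_prod_countable_left fun w => measurable_pi_apply w
    exact h.comp ((f.measurable_mean.comp measurable_fst).prodMk
      (measurable_fst.comp measurable_snd))
  have hFm : Measurable F := (measurable_mixDensity S (f.measurable_mean.comp measurable_fst)
    (h1.add (measurable_snd.comp measurable_snd))).log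
  have hF : Integrable F ((rowLaw n m N ν).prod (mixLaw M (Antenna n N))) :=
    (integrable_logBound.comp_snd _).mono' hFm.aestronglyMeasurable
      (ae_of_all _ fun p => abs_log_mixDensity_le _ S p.2.1 p.2.2)
  have hmp := measurePreserving_law (M := M) (n := n) (m := m) (N := N) ν
  refine ⟨(hmp.integrable_comp hFm.aestronglyMeasurable).2 hF, ?_⟩
  have e := integral_map hmp.measurable.aemeasurable hFm.aestronglyMeasurable (f := F)
    (μ := law M n m N ν)
  rw [hmp.map_eq, integral_prod _ hF] at e
  rw [avgEntropy, ← integral_neg]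
  refine e.symm.trans (integral_congr_ae (ae_of_all _ fun G => ?_))
  simp only [mixEntropy, integral_neg, neg_neg, F]

lemma map_blocks_gaussian :
    (Measure.pi fun _ : Fin n => Measure.pi fun j : Fin 3 => Measure.pi fun _ : Fin (N j) =>
      complexGaussian).map (fun z => (((fun t => z t 1), (fun t => z t 2)), fun t => z t 0)) =
      (volume.withDensity fun y : (Fin n → Fin (N 1) → ℂ) × (Fin n → Fin (N 2) → ℂ) =>
        blockDensity y.1 * blockDensity y.2).prod (volume.withDensity blockDensity) := by
  rw [map_blocks complexGaussian]
  simp only [pi_pi_complexGaussian]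
  rw [prod_withDensity measurable_blockDensity measurable_blockDensity, Measure.volume_eq_prod]

lemma map_blocks_gaussian' :
    (Measure.pi fun _ : Fin n => Measure.pi fun j : Fin 3 => Measure.pi fun _ : Fin (N j) =>
      complexGaussian).map (fun z => ((fun t => z t 2), fun t => z t 1)) =
      (volume.withDensity (blockDensity : (Fin n → Fin (N 2) → ℂ) → ℝ≥0∞)).prod
        (volume.withDensity blockDensity) := by
  have h := congrArg (Measure.map (Prod.swap ∘ Prod.fst)) (map_blocks (n := n) (N := N) complexGaussian)
  rw [Measure.map_map (by fun_prop) (by fun_prop),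
    ← Measure.map_map measurable_swap measurable_fst, Measure.map_fst_prod, measure_univ, one_smul,
    Measure.prod_swap] at h
  simp only [pi_pi_complexGaussian] at h
  exact h

/-- The chain rule: for given channel the conditional density is a quotient of two mixture
densities. -/
lemma condDiffEntropy_first (f : Encoder M n m (N 0)) (ν : Measure ℂ) [IsProbabilityMeasure ν] :
    HasCondDiffEntropy (law M n m N ν) (f.output 0)
        (fun ω => (f.output 1 ω, f.output 2 ω, ω.2.1)) ∧
      condDiffEntropy (law M n m N ν) (f.output 0)
        (fun ω => (f.output 1 ω, f.output 2 ω, ω.2.1)) =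
        avgEntropy f ν (receiver n N 0 ∪ (receiver n N 1 ∪ receiver n N 2)) -
          avgEntropy f ν (receiver n N 1 ∪ receiver n N 2) := by
  have h12 : Disjoint (receiver n N 1) (receiver n N 2) := disjoint_receiver (by decide)
  have h0 : Disjoint (receiver n N 0) (receiver n N 1 ∪ receiver n N 2) :=
    Finset.disjoint_union_right.2 ⟨disjoint_receiver (by decide), disjoint_receiver (by decide)⟩
  obtain ⟨i1, e1⟩ := logDensity_spec f ν (receiver n N 0 ∪ (receiver n N 1 ∪ receiver n N 2))
  obtain ⟨i2, e2⟩ := logDensity_spec f ν (receiver n N 1 ∪ receiver n N 2)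
  have hσ : SigmaFinite (volume : Measure ((Fin n → Fin (N 1) → ℂ) × (Fin n → Fin (N 2) → ℂ))) :=
    Measure.prod.instSigmaFinite
  have hadd : (volume : Measure ((Fin n → Fin (N 1) → ℂ) ×
      (Fin n → Fin (N 2) → ℂ))).IsAddLeftInvariant := Measure.prod.instIsAddLeftInvariant
  have key := condDiffEntropy_mixture (M := M)
    (Γ := Measure.pi fun _ : Fin n => Measure.pi fun j : Fin 3 => Measure.pi fun _ : Fin (N j) =>
      Measure.pi fun _ : Fin m => ν)
    (eB := fun z : Noise n N => ((fun t => z t 1), fun t => z t 2)) (eA := fun z t => z t 0)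
    (α := Fin n → Fin (N 0) → ℂ) (β := (Fin n → Fin (N 1) → ℂ) × (Fin n → Fin (N 2) → ℂ))
    (by fun_prop) (by fun_prop) (by fun_prop) measurable_blockDensity map_blocks_gaussian
    (lintegral_blockDensity n (N 0))
    (fun y => mul_ne_zero (blockDensity_ne_zero _) (blockDensity_ne_zero _))
    (fun y => ENNReal.mul_ne_top (blockDensity_ne_top _) (blockDensity_ne_top _))
    (fun g w => ((fun t r => f.mean (flatten g) w ⟨t, 1, r⟩),
      fun t r => f.mean (flatten g) w ⟨t, 2, r⟩))
    (fun g w t r => f.mean (flatten g) w ⟨t, 0, r⟩)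
    (fun w => (f.measurable_mean_flatten 1 w).prodMk (f.measurable_mean_flatten 2 w))
    (f.measurable_mean_flatten 0) MeasurableEquiv.prodAssoc
    (fun ω => (f.output 1 ω, f.output 2 ω, ω.2.1)) (f.output 0) (fun ω => rfl) (fun ω => rfl)
    (i1.sub i2) (fun w g z => ?_)
  · refine ⟨key.1, key.2.trans ?_⟩
    change -∫ ω, logDensity f _ ω - logDensity f _ ω ∂(law M n m N ν) = _
    rw [integral_sub i1 i2, e1, e2]
    ring
  · set μ := f.mean (flatten g) with hμ
    set y := μ w + flatten z with hy
    have s1 : shiftSum (fun y : (Fin n → Fin (N 1) → ℂ) × (Fin n → Fin (N 2) → ℂ) =>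
        blockDensity y.1 * blockDensity y.2) (fun w => ((fun t r => μ w ⟨t, 1, r⟩),
        fun t r => μ w ⟨t, 2, r⟩)) ((fun t r => y ⟨t, 1, r⟩), fun t r => y ⟨t, 2, r⟩) =
        ENNReal.ofReal (mixDensity μ (receiver n N 1 ∪ receiver n N 2) y) := by
      rw [ofReal_mixDensity]
      refine Finset.sum_congr rfl fun w _ => ?_
      rw [lik_union h12, ENNReal.ofReal_mul (lik_pos _ _ _).le, ← blockDensity_sub,
        ← blockDensity_sub]
      rfl
    have s2 : shiftSum₂ (fun y : (Fin n → Fin (N 1) → ℂ) × (Fin n → Fin (N 2) → ℂ) =>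
        blockDensity y.1 * blockDensity y.2) blockDensity (fun w => ((fun t r => μ w ⟨t, 1, r⟩),
        fun t r => μ w ⟨t, 2, r⟩)) (fun w t r => μ w ⟨t, 0, r⟩)
        (((fun t r => y ⟨t, 1, r⟩), fun t r => y ⟨t, 2, r⟩), fun t r => y ⟨t, 0, r⟩) =
        ENNReal.ofReal (mixDensity μ (receiver n N 0 ∪ (receiver n N 1 ∪ receiver n N 2)) y) := by
      rw [ofReal_mixDensity]
      refine Finset.sum_congr rfl fun w _ => ?_
      rw [lik_union h0, lik_union h12, mul_comm, ENNReal.ofReal_mul (lik_pos _ _ _).le,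
        ENNReal.ofReal_mul (lik_pos _ _ _).le, ← blockDensity_sub, ← blockDensity_sub, ← blockDensity_sub]
      rfl
    refine Eq.trans ?_ (log_ofReal_div_ofReal (mixDensity_pos μ _ y) (mixDensity_pos μ _ y))
    rw [← s1, ← s2]
    rfl

lemma condDiffEntropy_second (f : Encoder M n m (N 0)) (ν : Measure ℂ) [IsProbabilityMeasure ν] :
    HasCondDiffEntropy (law M n m N ν) (f.output 1) (fun ω => (f.output 2 ω, ω.2.1)) ∧
      condDiffEntropy (law M n m N ν) (f.output 1) (fun ω => (f.output 2 ω, ω.2.1)) =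
        avgEntropy f ν (receiver n N 1 ∪ receiver n N 2) - avgEntropy f ν (receiver n N 2) := by
  have h12 : Disjoint (receiver n N 1) (receiver n N 2) := disjoint_receiver (by decide)
  obtain ⟨i1, e1⟩ := logDensity_spec f ν (receiver n N 1 ∪ receiver n N 2)
  obtain ⟨i2, e2⟩ := logDensity_spec f ν (receiver n N 2)
  have key := condDiffEntropy_mixture (M := M)
    (Γ := Measure.pi fun _ : Fin n => Measure.pi fun j : Fin 3 => Measure.pi fun _ : Fin (N j) =>
      Measure.pi fun _ : Fin m => ν)
    (eB := fun z : Noise n N => fun t => z t 2) (eA := fun z t => z t 1)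
    (by fun_prop) (by fun_prop) measurable_blockDensity measurable_blockDensity map_blocks_gaussian'
    (lintegral_blockDensity n (N 1)) blockDensity_ne_zero blockDensity_ne_top
    (fun g w t r => f.mean (flatten g) w ⟨t, 2, r⟩) (fun g w t r => f.mean (flatten g) w ⟨t, 1, r⟩)
    (f.measurable_mean_flatten 2) (f.measurable_mean_flatten 1) (MeasurableEquiv.refl _)
    (fun ω => (f.output 2 ω, ω.2.1)) (f.output 1) (fun ω => rfl) (fun ω => rfl)
    (i1.sub i2) (fun w g z => ?_)
  · refine ⟨key.1, key.2.trans ?_⟩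
    change -∫ ω, logDensity f _ ω - logDensity f _ ω ∂(law M n m N ν) = _
    rw [integral_sub i1 i2, e1, e2]
    ring
  · set μ := f.mean (flatten g) with hμ
    set y := μ w + flatten z with hy
    have s1 := shiftSum_blockDensity μ 2 y
    have s2 : shiftSum₂ blockDensity blockDensity (fun w t r => μ w ⟨t, 2, r⟩)
        (fun w t r => μ w ⟨t, 1, r⟩) ((fun t r => y ⟨t, 2, r⟩), fun t r => y ⟨t, 1, r⟩) =
        ENNReal.ofReal (mixDensity μ (receiver n N 1 ∪ receiver n N 2) y) := by
      rw [ofReal_mixDensity]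
      refine Finset.sum_congr rfl fun w _ => ?_
      rw [lik_union h12, mul_comm, ENNReal.ofReal_mul (lik_pos _ _ _).le, ← blockDensity_sub,
        ← blockDensity_sub]
    refine Eq.trans ?_ (log_ofReal_div_ofReal (mixDensity_pos μ _ y) (mixDensity_pos μ _ y))
    rw [← s1, ← s2]
    rfl

/-- `powerAt` uses the sup norm, which the Euclidean norm of the power constraint dominates. -/
lemma Encoder.ofReal_powerAt_le (f : Encoder M n m (N 0)) (t : Fin n)
    (G : Antenna n N → Fin m → ℂ) : ENNReal.ofReal (f.powerAt t G) ≤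
      ∫⁻ w, ∑ i, ENNReal.ofReal (‖f.inputAt t w G i‖ ^ 2) ∂(messageLaw M) := by
  rw [Encoder.powerAt, ofReal_integral_eq_lintegral_ofReal Integrable.of_finite
    (ae_of_all _ fun w => sq_nonneg _)]
  refine lintegral_mono fun w => ?_
  rw [← ENNReal.ofReal_sum_of_nonneg fun i _ => sq_nonneg _]
  refine ENNReal.ofReal_le_ofReal ?_
  have hs : 0 ≤ ∑ i, ‖f.inputAt t w G i‖ ^ 2 := Finset.sum_nonneg fun i _ => sq_nonneg _
  rw [← Real.sqrt_le_sqrt_iff hs, Real.sqrt_sq (norm_nonneg _)]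
  refine (pi_norm_le_iff_of_nonneg (Real.sqrt_nonneg _)).2 fun i => Real.le_sqrt_of_sq_le ?_
  exact Finset.single_le_sum (f := fun i => ‖f.inputAt t w G i‖ ^ 2)
    (fun i _ => sq_nonneg _) (Finset.mem_univ i)

lemma Encoder.PowerConstraint.integrable {f : Encoder M n m (N 0)} {ν : Measure ℂ}
    [IsProbabilityMeasure ν] {p : ℝ} (hp : 0 ≤ p) (h : f.PowerConstraint ν p) :
    (∀ t, Integrable (fun G => f.powerAt t G) (rowLaw n m N ν)) ∧
      ∑ t, ∫ G, f.powerAt t G ∂(rowLaw n m N ν) ≤ n * p := by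
  have hmp := measurePreserving_law (M := M) (n := n) (m := m) (N := N) ν
  have hm1 : ∀ t, Measurable fun q : (Antenna n N → Fin m → ℂ) × Fin M =>
      f.inputAt t q.2 q.1 := fun t => measurable_from_prod_countable_left (f.measurable_inputAt t)
  have hm : Measurable fun q : (Antenna n N → Fin m → ℂ) × (Fin M × (Antenna n N → ℂ)) =>
      ∑ t, ∑ i, ENNReal.ofReal (‖f.inputAt t q.2.1 q.1 i‖ ^ 2) := by
    refine Finset.measurable_sum _ fun t _ => Finset.measurable_sum _ fun i _ => ?_
    have : Measurable fun q : (Antenna n N → Fin m → ℂ) × (Fin M × (Antenna n N → ℂ)) =>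
      f.inputAt t q.2.1 q.1 i := (measurable_pi_apply i).comp ((hm1 t).comp
        (measurable_fst.prodMk (measurable_fst.comp measurable_snd)))
    fun_prop
  have hpm : ∀ t, Measurable fun G : Antenna n N → Fin m → ℂ => f.powerAt t G := fun t =>
    (Measurable.stronglyMeasurable (f := fun q : (Antenna n N → Fin m → ℂ) × Fin M =>
      ‖f.inputAt t q.2 q.1‖ ^ 2) (by fun_prop)).integral_prod_right'.measurable
  have h0 : ∀ t G, 0 ≤ f.powerAt (N := N) t G := fun t G => integral_nonneg fun w => sq_nonneg _
  have hb : ∑ t, ∫⁻ G, ENNReal.ofReal (f.powerAt t G) ∂(rowLaw n m N ν) ≤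
      ENNReal.ofReal (n * p) := by
    refine le_trans ?_ h
    have e := hmp.lintegral_comp hm
    refine le_of_le_of_eq ?_ e.symm
    rw [lintegral_prod _ hm.aemeasurable, ← lintegral_finsetSum _ fun t _ => (hpm t).ennreal_ofReal]
    refine lintegral_mono fun G => ?_
    have hm2 : Measurable fun q : Fin M × (Antenna n N → ℂ) =>
        ∑ t, ∑ i, ENNReal.ofReal (‖f.inputAt t q.1 G i‖ ^ 2) :=
      (measurable_of_finite fun w => ∑ t, ∑ i, ENNReal.ofReal (‖f.inputAt t w G i‖ ^ 2)).comp
        measurable_fst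
    simp only
    rw [mixLaw, lintegral_prod _ hm2.aemeasurable]
    simp only [lintegral_const, measure_univ, mul_one]
    refine (Finset.sum_le_sum fun t _ => f.ofReal_powerAt_le t G).trans (le_of_eq ?_)
    exact (lintegral_finsetSum Finset.univ fun t _ => measurable_of_finite
      fun w => ∑ i, ENNReal.ofReal (‖f.inputAt t w G i‖ ^ 2)).symm
  have hi : ∀ t, Integrable (fun G => f.powerAt t G) (rowLaw n m N ν) := fun t =>
    ⟨(hpm t).aestronglyMeasurable, (hasFiniteIntegral_iff_ofReal (ae_of_all _ (h0 t))).2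
      (((Finset.single_le_sum (f := fun t => ∫⁻ G, ENNReal.ofReal (f.powerAt t G)
        ∂(rowLaw n m N ν)) (fun _ _ => zero_le) (Finset.mem_univ t)).trans hb).trans_lt
        ENNReal.ofReal_lt_top)⟩
  refine ⟨hi, ?_⟩
  rw [← ENNReal.ofReal_le_ofReal_iff (by positivity), ENNReal.ofReal_sum_of_nonneg fun t _ =>
    integral_nonneg (h0 t)]
  simpa only [ofReal_integral_eq_lintegral_ofReal (hi _) (ae_of_all _ (h0 _))] using hb

end Link

/-! ### The choice of `δ` and the growth of the error term -/

lemma isLittleO_log_one_add_log_one_add :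
    (fun p : ℝ => Real.log (1 + Real.log (1 + p))) =o[atTop] Real.log := by
  have hlim : Tendsto (fun p : ℝ => 1 + Real.log (1 + p)) atTop atTop :=
    tendsto_atTop_add_const_left _ _
      (Real.tendsto_log_atTop.comp (tendsto_atTop_add_const_left _ _ tendsto_id))
  refine (Real.isLittleO_log_id_atTop.comp_tendsto hlim).trans_isBigO ?_
  refine Real.isLittleO_const_log_atTop.isBigO.add (IsBigO.of_bound 2 ?_)
  filter_upwards [eventually_ge_atTop 2] with p hp
  rw [Real.norm_of_nonneg (Real.log_nonneg (by linarith)),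
    Real.norm_of_nonneg (Real.log_nonneg (by linarith))]
  calc Real.log (1 + p) ≤ Real.log (p ^ 2) := Real.log_le_log (by linarith) (by nlinarith)
    _ = 2 * Real.log p := by rw [Real.log_pow]; norm_num

/-- The comparison constant for the noise level `1 / (1 + log (1 + p))` grows slower than `log p`
as soon as the bound `fmax` does. -/
lemma alignConst_add_le {K fmax p : ℝ} (hK : 0 ≤ K) (hf : 0 ≤ fmax) (hp : 0 < p) :
    alignConst K fmax (1 + Real.log (1 + p))⁻¹ p + (1 + Real.log (1 + p))⁻¹ * (2 * K) ≤
      (Real.log (2 * Real.pi) + 1 / Real.pi + Real.log 2 + 2 +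
        3 * (∫ z, ‖z‖ ^ 2 ∂complexGaussian) + 2 * K) +
      Real.log (1 + Real.log (1 + p)) + K * fmax := by
  have hπ := Real.pi_pos
  have hL : 0 < Real.log (1 + p) := Real.log_pos (by linarith)
  set L := Real.log (1 + p)
  set c := ∫ z, ‖z‖ ^ 2 ∂complexGaussian
  have hc : 0 ≤ c := integral_nonneg fun z => sq_nonneg _
  have e1 : Real.log (2 * Real.pi / (1 + L)⁻¹) = Real.log (2 * Real.pi) + Real.log (1 + L) := by
    rw [div_inv_eq_mul, Real.log_mul (by positivity) (by positivity)]
  -- The logarithm is bounded linearly; growth of order `o(log p)` for `fmax` suffices for this.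
  have e2 : Real.log (1 / Real.pi + K * fmax) ≤ 1 / Real.pi + K * fmax - 1 :=
    Real.log_le_sub_one_of_pos (by positivity)
  have hd0 : 0 ≤ (1 + L)⁻¹ := by positivity
  have hd1 : (1 + L)⁻¹ ≤ 1 := inv_le_one_of_one_le₀ (by linarith)
  have hdL : (1 + L)⁻¹ * L ≤ 1 := by
    rw [inv_mul_le_iff₀ (by positivity)]
    linarith
  have e3 : (1 + L)⁻¹ * ((1 + 2 * c) / (1 + p)) ≤ 1 + 2 * c :=
    (mul_le_of_le_one_left (by positivity) hd1).trans
      (div_le_self (by positivity) (by linarith))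
  have e4 : (1 + L)⁻¹ * (2 * K) ≤ 2 * K := mul_le_of_le_one_left (by positivity) hd1
  rw [alignConst, e1, mul_add]
  linarith

end MIMOME

theorem mainTheorem3 (m : ℕ) (N : Fin 3 → ℕ) (hN : ∀ j, 0 < N j) (hm : N 0 + N 1 + N 2 ≤ m)
    (dmax : ℝ) (fmax : ℝ → ℝ) (hfmax : fmax =o[atTop] Real.log) :
    ∃ ε : ℝ → ℝ, ε =o[atTop] Real.log ∧
      ∀ (p : ℝ), 0 < p → ∀ (ν : Measure ℂ), MIMOME.IsChannelLaw dmax (fmax p) ν →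
        ∀ (n M : ℕ) [NeZero M] (f : MIMOME.Encoder M n m (N 0)), f.PowerConstraint ν p →
          MIMOME.HasCondDiffEntropy (MIMOME.law M n m N ν)
              (f.output 0) (fun ω => (f.output 1 ω, f.output 2 ω, ω.2.1)) ∧
          MIMOME.HasCondDiffEntropy (MIMOME.law M n m N ν)
              (f.output 1) (fun ω => (f.output 2 ω, ω.2.1)) ∧
          MIMOME.condDiffEntropy (MIMOME.law M n m N ν)
              (f.output 0) (fun ω => (f.output 1 ω, f.output 2 ω, ω.2.1)) / (N 0 : ℝ) ≤
            MIMOME.condDiffEntropy (MIMOME.law M n m N ν)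
              (f.output 1) (fun ω => (f.output 2 ω, ω.2.1)) / (N 1 : ℝ) + n * ε p := by
  set K : ℝ := (m * dmax) ^ 2 with hK
  -- The witness is the bound of `alignConst_add_le`: a constant, a `log log` term from `log (1/δ)`,
  -- and a multiple of `fmax p`.
  refine ⟨fun p => (Real.log (2 * Real.pi) + 1 / Real.pi + Real.log 2 + 2 +
        3 * (∫ z, ‖z‖ ^ 2 ∂MIMOME.complexGaussian) + 2 * K) +
      Real.log (1 + Real.log (1 + p)) + K * fmax p,
    (Real.isLittleO_const_log_atTop.add MIMOME.isLittleO_log_one_add_log_one_add).add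
      (hfmax.const_mul_left K), fun p hp ν hν n M _ f hf => ?_⟩
  have := hν.isProbabilityMeasure
  obtain ⟨h1, e1⟩ := MIMOME.condDiffEntropy_first f ν
  obtain ⟨h2, e2⟩ := MIMOME.condDiffEntropy_second f ν
  refine ⟨h1, h2, ?_⟩
  rw [e1, e2]
  obtain ⟨hP, hsum⟩ := hf.integrable hp.le
  have hL : 0 < Real.log (1 + p) := Real.log_pos (by linarith)
  have key := MIMOME.avgEntropy_blocks_le f hν (δ := (1 + Real.log (1 + p))⁻¹) (by positivity) hp
    hP hsum
  have hε := mul_le_mul_of_nonneg_left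
    (MIMOME.alignConst_add_le (K := K) (sq_nonneg _) hν.fmax_nonneg hp) (Nat.cast_nonneg (α := ℝ) n)
  have h0 : (0 : ℝ) < N 0 := Nat.cast_pos.2 (hN 0)
  have h1 : (0 : ℝ) < N 1 := Nat.cast_pos.2 (hN 1)
  refine le_trans ?_ (add_le_add_right hε _)
  rw [← mul_le_mul_iff_of_pos_left (mul_pos h0 h1)]
  refine le_trans (le_of_eq ?_) (key.trans (le_of_eq ?_))
  · field_simp
  · rw [← hK]
    field_simp
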